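/- Let $p\ge 1$ be an integer, $\beta>0$ a real number, and $Q$ a real symmetric positive definite $p\times p$ matrix. For $\varepsilon>0$ and $\theta=(\theta_i)_{i\ge1}$ with $\theta_i\in\mathbb{R}^p$, let $y=(y_i)_{i\ge 1}$ be observed from the multivariate Gaussian sequence model $y_i=\theta_i+\varepsilon\xi_i$, $i=1,2,\dots$, where the $\xi_i\sim \mathrm{N}_p(0,I_p)$ are independent. Let $$a_{\beta,i}=\begin{cases} i^\beta, & i \text{ even},\\ (i-1)^\beta, & i\text{ odd},\end{cases}\qquad \Theta(\beta,Q)=\Big\{\theta=(\theta_1,\theta_2,\dots)\ \Big|\ \sum_{i=1}^\infty a_{\beta,i}^2\,\theta_i^\top Q^{-1}\theta_i\le 1\Big\}.$$ An estimator is a measurable function $\hat\theta=\hat\theta(y)$ with values in $(\mathbb{R}^p)^{\mathbb N}$; its risk is $$R_Q(\theta,\hat\theta)=\mathrm{E}_\theta\Big[\sum_{i=1}^\infty(\hat\theta_i-\theta_i)^\top Q(\hat\theta_i-\theta_i)\Big]\in[0,\infty].$$ For a symmetric matrix $S$ with spectral decomposition $S=U^\top\mathrm{diag}(\lambda_1,\dots,\lambda_p)U$,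 put $S_+=U^\top\mathrm{diag}(\max(0,\lambda_1),\dots,\max(0,\lambda_p))U$. Then for every $\varepsilon>0$ the equation $$\varepsilon^2\kappa^{-1}\sum_{i=1}^\infty a_{\beta,i}\,\mathrm{tr}\,(I_p-a_{\beta,i}\kappa Q^{-1})_+=1$$ has a unique solution $\kappa=\kappa_\varepsilon>0$. Let $\hat\theta_{\mathrm P}$ be the linear estimator $\hat\theta_{\mathrm P,i}=C_{\mathrm P,i}\,y_i$ with $C_{\mathrm P,i}=(I_p-a_{\beta,i}\kappa_\varepsilon Q^{-1})_+$. Then $\hat\theta_{\mathrm P}$ is asymptotically minimax on $\Theta(\beta,Q)$: as $\varepsilon\to0$, $$\sup_{\theta\in\Theta(\beta,Q)}R_Q(\theta,\hat\theta_{\mathrm P})\ \sim\ \inf_{\hat\theta}\ \sup_{\theta\in\Theta(\beta,Q)}R_Q(\theta,\hat\theta)\ \sim\ P(\beta,Q)\,\varepsilon^{4\beta/(2\beta+1)},$$ where the infimum is over all estimators (which may depend on $\varepsilon$, $\beta$ and $Q$), $u\sim v$ means $u/v\to1$, and $$P(\beta,Q)=(2\beta+1)^{1/(2\beta+1)}\left(\frac{\beta\,\mathrm{tr}(Q^{(\beta+1)/\beta})}{\beta+1}\right)^{2\beta/(2\beta+1)}.$$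 -/

import Mathlib

open MeasureTheory ProbabilityTheory Filter Topology
open scoped ENNReal Matrix

noncomputable section

namespace MPinsker

/-- Sequences `(x₁, x₂, …)` of vectors in `ℝᵖ`. The vector `x_{i+1}` of the usual numbering from `1`
is stored at index `i : ℕ`. -/
abbrev Seq (p : ℕ) : Type := ℕ → Fin p → ℝ

/-- The Sobolev coefficient `a_{β,k}`, numbered from `k = 1`: `k ^ β` for even `k` and
`(k - 1) ^ β` for odd `k`. It is only used at `k = i + 1`. -/
def sobolevCoeff (β : ℝ) (k : ℕ) : ℝ :=
  if Even k then (k : ℝ) ^ β else ((k : ℝ) - 1) ^ β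

/-- The quadratic form `xᵀ A x`. -/
def quadForm {p : ℕ} (A : Matrix (Fin p) (Fin p) ℝ) (x : Fin p → ℝ) : ℝ :=
  x ⬝ᵥ (A *ᵥ x)

/-- The multivariate Sobolev ellipsoid: `∑ₖ a_{β,k}² θₖᵀ Q⁻¹ θₖ ≤ 1`. -/
def sobolevEllipsoid {p : ℕ} (β : ℝ) (Q : Matrix (Fin p) (Fin p) ℝ) : Set (Seq p) :=
  {θ | ∑' i : ℕ, ENNReal.ofReal (sobolevCoeff β (i + 1) ^ 2 * quadForm Q⁻¹ (θ i)) ≤ 1}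

/-- Law of the noise `(ξ₁, ξ₂, …)`: the `ξᵢ` are independent with law `N_p(0, I_p)`. -/
def noiseLaw (p : ℕ) : Measure (Seq p) :=
  Measure.infinitePi fun _ : ℕ => Measure.pi fun _ : Fin p => gaussianReal 0 1

/-- Law of the observation `yᵢ = θᵢ + ε ξᵢ`, `i = 1, 2, …`. -/
def observationLaw {p : ℕ} (ε : ℝ) (θ : Seq p) : Measure (Seq p) :=
  (noiseLaw p).map fun ξ i => θ i + ε • ξ i

/-- An estimator is a measurable function of the observation `y`. -/
def Estimator (p : ℕ) : Type := {f : Seq p → Seq p // Measurable f}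

/-- The quadratic loss `L_Q(θ, t) = ∑ᵢ (tᵢ - θᵢ)ᵀ Q (tᵢ - θᵢ)`, possibly infinite. -/
def loss {p : ℕ} (Q : Matrix (Fin p) (Fin p) ℝ) (θ t : Seq p) : ℝ≥0∞ :=
  ∑' i : ℕ, ENNReal.ofReal (quadForm Q (t i - θ i))

/-- The risk `R_Q(θ, f) = E_θ [L_Q(θ, f(y))]` at noise level `ε`. -/
def risk {p : ℕ} (Q : Matrix (Fin p) (Fin p) ℝ) (ε : ℝ) (θ : Seq p) (f : Estimator p) : ℝ≥0∞ :=
  ∫⁻ y, loss Q θ (f.1 y) ∂(observationLaw ε θ)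

/-- The maximal risk of an estimator over a parameter space. -/
def maxRisk {p : ℕ} (Q : Matrix (Fin p) (Fin p) ℝ) (ε : ℝ) (Θ : Set (Seq p)) (f : Estimator p) :
    ℝ≥0∞ :=
  ⨆ θ ∈ Θ, risk Q ε θ f

/-- The minimax risk over a parameter space. -/
def minimaxRisk {p : ℕ} (Q : Matrix (Fin p) (Fin p) ℝ) (ε : ℝ) (Θ : Set (Seq p)) : ℝ≥0∞ :=
  ⨅ f : Estimator p, maxRisk Q ε Θ f

/-- The positive part `S₊` of a symmetric matrix: every eigenvalue `λ` is replaced by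
`max 0 λ` in a spectral decomposition. -/
def matPosPart {p : ℕ} (S : Matrix (Fin p) (Fin p) ℝ) : Matrix (Fin p) (Fin p) ℝ :=
  cfc (fun x : ℝ => max 0 x) S

/-- The real power `A ^ r` of a positive definite matrix: every eigenvalue `λ` is replaced by
`λ ^ r` in a spectral decomposition. -/
def matRpow {p : ℕ} (A : Matrix (Fin p) (Fin p) ℝ) (r : ℝ) : Matrix (Fin p) (Fin p) ℝ :=
  cfc (fun x : ℝ => x ^ r) A

/-- The coefficient matrix `(I_p - a_{β,k} κ Q⁻¹)₊` with `k = i + 1`. -/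
def pinskerCoeff {p : ℕ} (β : ℝ) (Q : Matrix (Fin p) (Fin p) ℝ) (κ : ℝ) (i : ℕ) :
    Matrix (Fin p) (Fin p) ℝ :=
  matPosPart (1 - (sobolevCoeff β (i + 1) * κ) • Q⁻¹)

/-- `κ` is a positive solution of `ε² κ⁻¹ ∑ₖ a_{β,k} tr (I_p - a_{β,k} κ Q⁻¹)₊ = 1`. -/
def IsPinskerRoot {p : ℕ} (β : ℝ) (Q : Matrix (Fin p) (Fin p) ℝ) (ε κ : ℝ) : Prop :=
  0 < κ ∧
    ε ^ 2 * κ⁻¹ * ∑' i : ℕ, sobolevCoeff β (i + 1) * (pinskerCoeff β Q κ i).trace = 1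

/-- The linear estimator `yᵢ ↦ Cᵢ yᵢ`. -/
def linearEstimator {p : ℕ} (C : ℕ → Matrix (Fin p) (Fin p) ℝ) : Estimator p :=
  ⟨fun y i => C i *ᵥ y i, by
    refine measurable_pi_iff.2 fun i => measurable_pi_iff.2 fun j => ?_
    simp only [Matrix.mulVec, dotProduct]
    fun_prop⟩

/-- The Pinsker constant `P(β, Q)`. -/
def pinskerConst {p : ℕ} (β : ℝ) (Q : Matrix (Fin p) (Fin p) ℝ) : ℝ :=
  (2 * β + 1) ^ (1 / (2 * β + 1)) *
    (β * (matRpow Q ((β + 1) / β)).trace / (β + 1)) ^ (2 * β / (2 * β + 1))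

/-- `u ~ v` as `ε → 0` through positive values: the ratio tends to `1`. -/
def AsympEquiv (u v : ℝ → ℝ≥0∞) : Prop :=
  Tendsto (fun ε => u ε / v ε) (𝓝[>] 0) (𝓝 1)

end MPinsker

end

/-! Rotating every vector by the eigenbasis of `Q` preserves the noise law and turns the problem
into a diagonal one: independent scalar coordinates indexed by (frequency `i`, eigenvalue `q j`),
loss weights `q j` and ellipsoid weights `a² / q j` (`IsDiagonalization.risk_eq`,
`mem_sobolevEllipsoid_iff`). The Pinsker filter becomes the scalar weight `w = (1 - aκ/q)₊`.

Upper bound (`diagRisk_pinsker_le`). Since `1 - w ≤ aκ/q`, the squared bias over the ellipsoid is at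
most `κ²`, and the variance is `ε² ∑ q w²`. The equation for `κ` says `κ = ε² ∑ a w`. With `w · aκ/q
= w(1 - w)` this makes the total exactly `pinskerBound = ε² ∑ q w`.

Lower bound (`lower_bound_of_diagRisk_le`). Take independent centred Gaussian priors on the
coordinates, with variances `(1 - δ) ε² q w/(κ a)`. Without the factor `1 - δ` the Bayes rule has
exactly the weights `w`, and the expected ellipsoid form over all frequencies is `1`, by the
equation for `κ`. In a Gaussian model the residual of the linear rule is independent of the data, so
no estimator beats it (`bayes_risk_coord`). The prior may leave the ellipsoid. Truncating the
estimator bounds the loss there by a multiple of `(S - m)²`, with `S` the ellipsoid form and `m` its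
mean, and hence by a variance (`truncation_loss_le`, `bayes_risk_le_of_diagRisk_le`). Dropping the
lowest `n` frequencies keeps that multiple small.

Asymptotics. With mesh `(κ/q)^(1/β)` the sums over `i` are Riemann sums of `(1 - x^β)₊` and `x^β (1
- x^β)₊` (`tendsto_mul_tsum_tagged`). As `κ → 0`, the first gives the size of `pinskerBound`, and
the second expresses `κ` through `ε` (`tendsto_rate_div`). Choosing `δ` as a small power of `κ`
makes all losses in the lower bound negligible (`eventually_lower_bound`), and both bounds meet. -/

noncomputable section

namespace MPinsker

/-! ### Sobolev coefficients, Riemann sums and the two limiting integrals. -/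

/-- The even number `m` with `a_{β,i+1} = m ^ β`. -/
def sobolevIndex (i : ℕ) : ℕ := if Even (i + 1) then i + 1 else i

lemma sobolevCoeff_succ (β : ℝ) (i : ℕ) :
    sobolevCoeff β (i + 1) = (sobolevIndex i : ℝ) ^ β := by
  unfold sobolevCoeff sobolevIndex
  split_ifs <;> simp

lemma le_sobolevIndex (i : ℕ) : (i : ℝ) ≤ sobolevIndex i := by
  unfold sobolevIndex
  split_ifs <;> simp

lemma sobolevIndex_le (i : ℕ) : (sobolevIndex i : ℝ) ≤ i + 1 := by
  unfold sobolevIndex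
  split_ifs <;> simp

lemma sobolevCoeff_nonneg (β : ℝ) (i : ℕ) : 0 ≤ sobolevCoeff β (i + 1) := by
  rw [sobolevCoeff_succ]; positivity

lemma rpow_le_sobolevCoeff {β : ℝ} (hβ : 0 < β) (i : ℕ) :
    (i : ℝ) ^ β ≤ sobolevCoeff β (i + 1) := by
  rw [sobolevCoeff_succ]
  exact Real.rpow_le_rpow (by positivity) (le_sobolevIndex i) hβ.le

lemma tendsto_sobolevCoeff {β : ℝ} (hβ : 0 < β) :
    Tendsto (fun i => sobolevCoeff β (i + 1)) atTop atTop :=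
  tendsto_atTop_mono (rpow_le_sobolevCoeff hβ)
    ((tendsto_rpow_atTop hβ).comp tendsto_natCast_atTop_atTop)

/-- Riemann sums of a continuous function that vanishes on `[1, ∞)`, with tags in `[i h, (i+1) h]`,
converge to its integral. -/
theorem tendsto_mul_tsum_tagged {φ : ℝ → ℝ} (hφ : Continuous φ) (h0 : ∀ x, 1 ≤ x → φ x = 0)
    {m : ℕ → ℝ} (hm : ∀ i : ℕ, (i : ℝ) ≤ m i) (hm' : ∀ i : ℕ, m i ≤ i + 1) :
    Tendsto (fun h : ℝ => h * ∑' i, φ (h * m i)) (𝓝[>] 0) (𝓝 (∫ x in (0 : ℝ)..1, φ x)) := by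
  rw [Metric.tendsto_nhds]
  intro η hη
  -- The interval reaches to `2` because the last cell may overshoot `1` by up to `h < 1`.
  have huc := (isCompact_Icc (a := (0 : ℝ)) (b := 2)).uniformContinuousOn_of_continuous
    hφ.continuousOn
  rw [Metric.uniformContinuousOn_iff] at huc
  obtain ⟨δ, hδ, H⟩ := huc (η / 4) (by positivity)
  have hsmall : ∀ᶠ h : ℝ in 𝓝[>] 0, h < min δ 1 :=
    (eventually_lt_nhds (lt_min hδ one_pos)).filter_mono nhdsWithin_le_nhds
  filter_upwards [hsmall, self_mem_nhdsWithin] with h hh hpos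
  have hpos : 0 < h := hpos
  have hhδ : h < δ := hh.trans_le (min_le_left _ _)
  have hh1 : h < 1 := hh.trans_le (min_le_right _ _)
  -- Tags with index at least `N` lie beyond `1`, where `φ` vanishes, so both the series and the
  -- integral reduce to `N` cells of total length at most `2`.
  set N := ⌈1 / h⌉₊ with hN
  have hN1 : 1 ≤ N * h := by
    have := Nat.le_ceil (1 / h)
    rwa [div_le_iff₀ hpos] at this
  have hN2 : N * h ≤ 2 := by
    have := (Nat.ceil_lt_add_one (a := 1 / h) (by positivity)).le
    have h3 : (N : ℝ) * h ≤ (1 / h + 1) * h := by gcongr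
    have h4 : (1 / h + 1) * h = 1 + h := by field_simp
    linarith
  have hsum : ∑' i, φ (h * m i) = ∑ i ∈ Finset.range N, φ (h * m i) := by
    refine tsum_eq_sum fun i hi => h0 _ ?_
    have hi : (N : ℝ) ≤ i := by exact_mod_cast not_lt.1 (by simpa using hi)
    nlinarith [hm i]
  have hint : ∀ a b : ℝ, IntervalIntegrable φ volume a b := fun a b => hφ.intervalIntegrable a b
  have hI : ∫ x in (0 : ℝ)..1, φ x
      = ∑ i ∈ Finset.range N, ∫ x in ((i : ℕ) * h : ℝ)..((i + 1 : ℕ) * h : ℝ), φ x := by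
    rw [intervalIntegral.sum_integral_adjacent_intervals (a := fun k : ℕ => (k : ℝ) * h)
      (fun k _ => hint _ _)]
    have : ∫ x in (1 : ℝ)..(N * h), φ x = 0 := by
      refine intervalIntegral.integral_zero_ae (Eventually.of_forall fun x hx => h0 x ?_)
      rw [Set.uIoc_of_le hN1] at hx
      exact hx.1.le
    have h2 := intervalIntegral.integral_add_adjacent_intervals (hint 0 1) (hint 1 (N * h))
    rw [this, add_zero] at h2
    simpa using h2
  rw [hsum, hI, Finset.mul_sum, dist_eq_norm, ← Finset.sum_sub_distrib]
  have hterm : ∀ i ∈ Finset.range N,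
      ‖h * φ (h * m i) - ∫ x in ((i : ℕ) * h : ℝ)..((i + 1 : ℕ) * h : ℝ), φ x‖ ≤ η / 4 * h := by
    intro i hi
    have hiN : (i : ℝ) + 1 ≤ N := by exact_mod_cast Finset.mem_range.1 hi
    have hle : (i : ℝ) * h ≤ ((i + 1 : ℕ) : ℝ) * h := by push_cast; nlinarith
    have e1 : h * φ (h * m i)
        = ∫ x in ((i : ℕ) * h : ℝ)..((i + 1 : ℕ) * h : ℝ), φ (h * m i) := by
      rw [intervalIntegral.integral_const]; push_cast; rw [smul_eq_mul]; ring
    rw [e1, ← intervalIntegral.integral_sub (intervalIntegrable_const) (hint _ _)]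
    have := intervalIntegral.norm_integral_le_of_norm_le_const (a := (i : ℝ) * h)
      (b := ((i + 1 : ℕ) : ℝ) * h) (C := η / 4) (f := fun x => φ (h * m i) - φ x) ?_
    · refine this.trans (le_of_eq ?_)
      rw [abs_of_nonneg (by linarith)]; push_cast; ring
    · intro x hx
      rw [Set.uIoc_of_le hle] at hx
      push_cast at hx
      have hi0 : (0 : ℝ) ≤ i := by positivity
      have h5 := hm i
      have h6 := hm' i
      have h7 : (i : ℝ) * h ≤ h * m i := by nlinarith
      have h8 : h * m i ≤ (i + 1) * h := by nlinarith
      have h9 : ((i : ℝ) + 1) * h ≤ 2 := by nlinarith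
      have h10 : 0 ≤ (i : ℝ) * h := by positivity
      refine (H _ ⟨by linarith, by linarith⟩ _ ⟨by linarith [hx.1], by linarith [hx.2]⟩ ?_).le
      rw [Real.dist_eq, abs_lt]
      constructor <;> nlinarith [hx.1, hx.2]
  calc _ ≤ ∑ i ∈ Finset.range N, η / 4 * h := norm_sum_le_of_le _ hterm
    _ = η / 4 * (N * h) := by simp; ring
    _ ≤ η / 4 * 2 := by gcongr
    _ < η := by linarith

/-- The eigenvalue `(1 - a_{β,i+1} κ / q)₊` of the Pinsker coefficient matrix. -/
def pinskerWeight (β q κ : ℝ) (i : ℕ) : ℝ := max 0 (1 - sobolevCoeff β (i + 1) * κ * q⁻¹)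

lemma pinskerWeight_nonneg (β q κ : ℝ) (i : ℕ) : 0 ≤ pinskerWeight β q κ i := le_max_left _ _

lemma pinskerWeight_le_one {β q κ : ℝ} (hq : 0 < q) (hκ : 0 ≤ κ) (i : ℕ) :
    pinskerWeight β q κ i ≤ 1 := by
  have := sobolevCoeff_nonneg β i
  have : 0 ≤ sobolevCoeff β (i + 1) * κ * q⁻¹ := by positivity
  exact max_le zero_le_one (by linarith)

/-- The scaling behind all asymptotics: with mesh `h = (κ/q)^(1/β)`, the weight at frequency `i` is
`(1 - x^β)₊` at the tag `x = h * sobolevIndex i`. -/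
lemma sobolevCoeff_mul_mul_inv_eq_rpow {β q κ : ℝ} (hβ : 0 < β) (hq : 0 < q) (hκ : 0 < κ) (i : ℕ) :
    sobolevCoeff β (i + 1) * κ * q⁻¹ = ((κ / q) ^ (1 / β) * (sobolevIndex i : ℝ)) ^ β := by
  rw [sobolevCoeff_succ, Real.mul_rpow (by positivity) (by positivity), ← Real.rpow_mul
    (by positivity), one_div_mul_cancel hβ.ne', Real.rpow_one]
  ring

lemma eventually_pinskerWeight_eq_zero {β q κ : ℝ} (hβ : 0 < β) (hq : 0 < q) (hκ : 0 < κ) :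
    ∀ᶠ i in atTop, pinskerWeight β q κ i = 0 := by
  filter_upwards [(tendsto_sobolevCoeff hβ).eventually_ge_atTop (q / κ)] with i hi
  refine max_eq_left ?_
  rw [div_le_iff₀ hκ] at hi
  have : 1 ≤ sobolevCoeff β (i + 1) * κ * q⁻¹ := by
    rw [← div_eq_mul_inv, le_div_iff₀ hq]; linarith
  linarith

lemma summable_of_eventually_eq_zero {f : ℕ → ℝ} (h : ∀ᶠ i in atTop, f i = 0) : Summable f := by
  obtain ⟨N, hN⟩ := eventually_atTop.1 h
  exact summable_of_ne_finset_zero (s := Finset.range N) fun i hi => hN i (by simpa using hi)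

lemma summable_mul_pinskerWeight {β q κ : ℝ} (hβ : 0 < β) (hq : 0 < q) (hκ : 0 < κ) (f : ℕ → ℝ) :
    Summable fun i => f i * pinskerWeight β q κ i := by
  refine summable_of_eventually_eq_zero ?_
  filter_upwards [eventually_pinskerWeight_eq_zero hβ hq hκ] with i hi
  simp [hi]

lemma tendsto_div_rpow_nhdsGT {q r : ℝ} (hq : 0 < q) (hr : 0 < r) :
    Tendsto (fun κ : ℝ => (κ / q) ^ r) (𝓝[>] 0) (𝓝[>] 0) := by
  refine tendsto_nhdsWithin_iff.2 ⟨?_, ?_⟩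
  · have : Continuous fun κ : ℝ => (κ / q) ^ r :=
      (Real.continuous_rpow_const hr.le).comp (continuous_id.div_const q)
    simpa [Real.zero_rpow hr.ne'] using (this.tendsto 0).mono_left nhdsWithin_le_nhds
  · filter_upwards [self_mem_nhdsWithin] with κ hκ
    have : 0 < κ := hκ
    exact Set.mem_Ioi.2 (by positivity)

lemma integral_max_one_sub_rpow {β : ℝ} (hβ : 0 < β) :
    ∫ x in (0 : ℝ)..1, max 0 (1 - x ^ β) = β / (β + 1) := by
  have h1 : ∫ x in (0 : ℝ)..1, max 0 (1 - x ^ β) = ∫ x in (0 : ℝ)..1, (1 - x ^ β) := by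
    refine intervalIntegral.integral_congr fun x hx => max_eq_right ?_
    rw [Set.uIcc_of_le zero_le_one] at hx
    linarith [Real.rpow_le_one hx.1 hx.2 hβ.le]
  rw [h1, intervalIntegral.integral_sub intervalIntegrable_const
    (intervalIntegral.intervalIntegrable_rpow' (by linarith)), integral_rpow (Or.inl (by linarith))]
  rw [Real.zero_rpow (by linarith)]
  simp
  field_simp
  ring

lemma integral_rpow_mul_max_one_sub_rpow {β : ℝ} (hβ : 0 < β) :
    ∫ x in (0 : ℝ)..1, x ^ β * max 0 (1 - x ^ β) = β / ((β + 1) * (2 * β + 1)) := by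
  have h1 : ∫ x in (0 : ℝ)..1, x ^ β * max 0 (1 - x ^ β)
      = ∫ x in (0 : ℝ)..1, (x ^ β - x ^ (2 * β)) := by
    refine intervalIntegral.integral_congr fun x hx => ?_
    rw [Set.uIcc_of_le zero_le_one] at hx
    have : max 0 (1 - x ^ β) = 1 - x ^ β :=
      max_eq_right (by linarith [Real.rpow_le_one hx.1 hx.2 hβ.le])
    simp only [this]
    rw [mul_comm 2 β, Real.rpow_mul hx.1, Real.rpow_two]
    ring
  rw [h1, intervalIntegral.integral_sub (intervalIntegral.intervalIntegrable_rpow' (by linarith))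
    (intervalIntegral.intervalIntegrable_rpow' (by linarith)), integral_rpow (Or.inl (by linarith)),
    integral_rpow (Or.inl (by linarith))]
  rw [Real.zero_rpow (by linarith), Real.zero_rpow (by linarith)]
  simp
  field_simp
  ring

/-- Riemann sum of `(1 - x^β)₊`. The mesh contributes `q^(1/β)`, which combines with the loss weight
`q` into the exponent `(β+1)/β`. -/
theorem tendsto_rpow_mul_tsum_pinskerWeight {β q : ℝ} (hβ : 0 < β) (hq : 0 < q) :
    Tendsto (fun κ : ℝ => κ ^ (1 / β) * ∑' i, q * pinskerWeight β q κ i) (𝓝[>] 0)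
      (𝓝 (q ^ ((β + 1) / β) * (β / (β + 1)))) := by
  have hφ : Continuous fun x : ℝ => max 0 (1 - x ^ β) :=
    continuous_const.max (continuous_const.sub (Real.continuous_rpow_const hβ.le))
  have key := ((tendsto_mul_tsum_tagged hφ (fun x hx => max_eq_left (by
    linarith [Real.one_le_rpow hx hβ.le])) le_sobolevIndex sobolevIndex_le).comp
    (tendsto_div_rpow_nhdsGT hq (one_div_pos.2 hβ))).const_mul (q ^ ((β + 1) / β))
  rw [integral_max_one_sub_rpow hβ] at key
  refine key.congr' ?_
  filter_upwards [self_mem_nhdsWithin] with κ hκ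
  have hκ : 0 < κ := hκ
  simp only [Function.comp, ← sobolevCoeff_mul_mul_inv_eq_rpow hβ hq hκ]
  rw [tsum_mul_left, Real.div_rpow hκ.le hq.le, show (β + 1) / β = 1 + 1 / β by field_simp,
    Real.rpow_add hq, Real.rpow_one]
  have : q ^ (1 / β) ≠ 0 := by positivity
  have e : ∑' i, max 0 (1 - sobolevCoeff β (i + 1) * κ * q⁻¹) = ∑' i, pinskerWeight β q κ i := rfl
  rw [e]
  field_simp

/-- Here the coefficient is `(q/κ) x^β`, hence one more power of `κ`. The limit is that of the
previous theorem divided by `2β + 1`, and this ratio produces the factor `2β + 1` of the Pinsker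
constant. -/
theorem tendsto_rpow_mul_tsum_sobolevCoeff_mul {β q : ℝ} (hβ : 0 < β) (hq : 0 < q) :
    Tendsto (fun κ : ℝ => κ ^ (1 + 1 / β) * ∑' i, sobolevCoeff β (i + 1) * pinskerWeight β q κ i)
      (𝓝[>] 0) (𝓝 (q ^ ((β + 1) / β) * (β / ((β + 1) * (2 * β + 1))))) := by
  have hφ : Continuous fun x : ℝ => x ^ β * max 0 (1 - x ^ β) :=
    (Real.continuous_rpow_const hβ.le).mul
      (continuous_const.max (continuous_const.sub (Real.continuous_rpow_const hβ.le)))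
  have key := ((tendsto_mul_tsum_tagged hφ (fun x hx => by
    rw [max_eq_left (by linarith [Real.one_le_rpow hx hβ.le]), mul_zero])
    le_sobolevIndex sobolevIndex_le).comp
    (tendsto_div_rpow_nhdsGT hq (one_div_pos.2 hβ))).const_mul (q ^ ((β + 1) / β))
  rw [integral_rpow_mul_max_one_sub_rpow hβ] at key
  refine key.congr' ?_
  filter_upwards [self_mem_nhdsWithin] with κ hκ
  have hκ : 0 < κ := hκ
  simp only [Function.comp, ← sobolevCoeff_mul_mul_inv_eq_rpow hβ hq hκ]
  have e : ∀ i, sobolevCoeff β (i + 1) * κ * q⁻¹ * max 0 (1 - sobolevCoeff β (i + 1) * κ * q⁻¹)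
      = κ * q⁻¹ * (sobolevCoeff β (i + 1) * pinskerWeight β q κ i) := fun i => by
    unfold pinskerWeight; ring
  simp only [e]
  rw [tsum_mul_left, Real.div_rpow hκ.le hq.le, show (β + 1) / β = 1 + 1 / β by field_simp,
    Real.rpow_add hq, Real.rpow_add hκ, Real.rpow_one, Real.rpow_one]
  have : q ^ (1 / β) ≠ 0 := by positivity
  field_simp

/-! ### Existence, uniqueness and vanishing of the root `κ`. -/

/-- `κ⁻¹ ∑ᵢ a_{β,i+1} ∑ⱼ (1 - a_{β,i+1} κ / qⱼ)₊` as a function of `s = κ⁻¹`. -/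
def pinskerSum {p : ℕ} (β : ℝ) (q : Fin p → ℝ) (s : ℝ) : ℝ :=
  ∑' i, sobolevCoeff β (i + 1) * ∑ j, max 0 (s - sobolevCoeff β (i + 1) * (q j)⁻¹)

variable {p : ℕ} {β : ℝ} {q : Fin p → ℝ}

lemma inv_mul_pinskerWeight {κ : ℝ} (hκ : 0 < κ) (r : ℝ) (i : ℕ) :
    κ⁻¹ * pinskerWeight β r κ i = max 0 (κ⁻¹ - sobolevCoeff β (i + 1) * r⁻¹) := by
  unfold pinskerWeight
  rw [mul_max_of_nonneg _ _ (inv_nonneg.2 hκ.le), mul_zero]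
  congr 1
  field_simp

lemma inv_mul_tsum_eq_pinskerSum {κ : ℝ} (hκ : 0 < κ) :
    κ⁻¹ * ∑' i, sobolevCoeff β (i + 1) * ∑ j, pinskerWeight β (q j) κ i
      = pinskerSum β q κ⁻¹ := by
  unfold pinskerSum
  rw [← tsum_mul_left]
  refine tsum_congr fun i => ?_
  simp_rw [← inv_mul_pinskerWeight hκ, ← Finset.mul_sum]
  ring

/-- Coefficients tend to infinity, so below a fixed `S` the same finitely many terms matter.
Continuity and monotonicity then reduce to finite sums. -/
lemma exists_pinskerSum_eq_sum (hβ : 0 < β) (hq : ∀ j, 0 < q j) (S : ℝ) :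
    ∃ N, ∀ s ≤ S, pinskerSum β q s = ∑ i ∈ Finset.range N,
      sobolevCoeff β (i + 1) * ∑ j, max 0 (s - sobolevCoeff β (i + 1) * (q j)⁻¹) := by
  have h : ∀ᶠ i in atTop, ∀ j, S ≤ sobolevCoeff β (i + 1) * (q j)⁻¹ := by
    refine eventually_all.2 fun j => ?_
    exact ((tendsto_sobolevCoeff hβ).atTop_mul_const (inv_pos.2 (hq j))).eventually_ge_atTop S
  obtain ⟨N, hN⟩ := eventually_atTop.1 h
  refine ⟨N, fun s hs => tsum_eq_sum fun i hi => ?_⟩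
  rw [Finset.sum_eq_zero, mul_zero]
  intro j _
  exact max_eq_left (by linarith [hN i (by simpa using hi) j])

lemma pinskerSum_mono (hβ : 0 < β) (hq : ∀ j, 0 < q j) : Monotone (pinskerSum β q) := by
  intro s t hst
  obtain ⟨N, hN⟩ := exists_pinskerSum_eq_sum hβ hq t
  rw [hN s hst, hN t le_rfl]
  gcongr with i _ j _
  exact sobolevCoeff_nonneg β i

/-- A positive value forces some term with a positive coefficient and an active positive part, and
that term grows strictly. Positivity is needed because the function is constantly zero near `0`. -/
lemma pinskerSum_lt (hβ : 0 < β) (hq : ∀ j, 0 < q j) {s t : ℝ} (hst : s < t)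
    (hs : 0 < pinskerSum β q s) : pinskerSum β q s < pinskerSum β q t := by
  obtain ⟨N, hN⟩ := exists_pinskerSum_eq_sum hβ hq t
  rw [hN s hst.le] at hs ⊢
  rw [hN t le_rfl]
  have hmono : ∀ i j, max 0 (s - sobolevCoeff β (i + 1) * (q j)⁻¹)
      ≤ max 0 (t - sobolevCoeff β (i + 1) * (q j)⁻¹) := fun i j => by gcongr
  obtain ⟨i, hi, hi'⟩ := Finset.exists_lt_of_sum_lt (s := Finset.range N) (f := fun _ => (0 : ℝ))
    (by simpa using hs)
  have ha : 0 < sobolevCoeff β (i + 1) := by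
    rcases (sobolevCoeff_nonneg β i).eq_or_lt with h | h
    · simp [← h] at hi'
    · exact h
  obtain ⟨j, hj, hj'⟩ := Finset.exists_lt_of_sum_lt (s := (Finset.univ : Finset (Fin p)))
    (f := fun _ => (0 : ℝ)) (by simpa using (pos_of_mul_pos_right hi' ha.le))
  refine Finset.sum_lt_sum (fun i _ => mul_le_mul_of_nonneg_left
    (Finset.sum_le_sum fun j _ => hmono i j) (sobolevCoeff_nonneg β i)) ⟨i, hi, ?_⟩
  refine mul_lt_mul_of_pos_left (Finset.sum_lt_sum (fun j _ => hmono i j) ⟨j, hj, ?_⟩) ha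
  have h1 : 0 < s - sobolevCoeff β (i + 1) * (q j)⁻¹ := by simpa using hj'
  rw [max_eq_right h1.le, max_eq_right (by linarith)]
  linarith

lemma pinskerSum_zero (hq : ∀ j, 0 < q j) : pinskerSum β q 0 = 0 := by
  unfold pinskerSum
  have : ∀ i j, max 0 (0 - sobolevCoeff β (i + 1) * (q j)⁻¹) = 0 := fun i j => by
    have h1 := sobolevCoeff_nonneg β i
    have h2 := inv_pos.2 (hq j)
    exact max_eq_left (by nlinarith [mul_nonneg h1 h2.le])
  simp only [this, Finset.sum_const_zero, mul_zero, tsum_zero]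

lemma exists_le_pinskerSum (hp : 0 < p) (hβ : 0 < β) (hq : ∀ j, 0 < q j) (c : ℝ) :
    ∃ s, 0 ≤ s ∧ c ≤ pinskerSum β q s := by
  let j₀ : Fin p := ⟨0, hp⟩
  -- Index `1` is the first usable one: at index `0` the coefficient is `0 ^ β = 0`.
  have ha : 0 < sobolevCoeff β (1 + 1) := by
    rw [sobolevCoeff_succ]; simp [sobolevIndex]; positivity
  refine ⟨sobolevCoeff β (1 + 1) * (q j₀)⁻¹ + |c| / sobolevCoeff β (1 + 1), ?_, ?_⟩
  · have := hq j₀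
    positivity
  set s := sobolevCoeff β (1 + 1) * (q j₀)⁻¹ + |c| / sobolevCoeff β (1 + 1) with hs
  have hnn : ∀ i, 0 ≤ sobolevCoeff β (i + 1) *
      ∑ j, max 0 (s - sobolevCoeff β (i + 1) * (q j)⁻¹) := fun i =>
    mul_nonneg (sobolevCoeff_nonneg β i) (Finset.sum_nonneg fun j _ => le_max_left _ _)
  have hsum : Summable fun i => sobolevCoeff β (i + 1) *
      ∑ j, max 0 (s - sobolevCoeff β (i + 1) * (q j)⁻¹) := by
    refine summable_of_eventually_eq_zero ?_
    have h : ∀ᶠ i in atTop, ∀ j, s ≤ sobolevCoeff β (i + 1) * (q j)⁻¹ := by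
      refine eventually_all.2 fun j => ?_
      exact ((tendsto_sobolevCoeff hβ).atTop_mul_const (inv_pos.2 (hq j))).eventually_ge_atTop s
    filter_upwards [h] with i hi
    rw [Finset.sum_eq_zero, mul_zero]
    exact fun j _ => max_eq_left (by linarith [hi j])
  calc c ≤ |c| := le_abs_self c
    _ = sobolevCoeff β (1 + 1) * (s - sobolevCoeff β (1 + 1) * (q j₀)⁻¹) := by
      rw [hs]; field_simp; ring
    _ ≤ sobolevCoeff β (1 + 1) * max 0 (s - sobolevCoeff β (1 + 1) * (q j₀)⁻¹) := by
      gcongr; exact le_max_right _ _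
    _ ≤ sobolevCoeff β (1 + 1) * ∑ j, max 0 (s - sobolevCoeff β (1 + 1) * (q j)⁻¹) := by
      gcongr
      exact Finset.single_le_sum (f := fun j => max 0 (s - sobolevCoeff β (1 + 1) * (q j)⁻¹))
        (fun j _ => le_max_left _ _) (Finset.mem_univ j₀)
    _ ≤ pinskerSum β q s := hsum.le_tsum 1 fun i _ => hnn i

/-- The intermediate value theorem gives a solution between `0`, where the sum vanishes, and a point
where it reaches `c`. Strict growth at positive values gives uniqueness. -/
theorem existsUnique_pinskerSum_eq (hp : 0 < p) (hβ : 0 < β) (hq : ∀ j, 0 < q j) {c : ℝ}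
    (hc : 0 < c) : ∃! s, 0 < s ∧ pinskerSum β q s = c := by
  obtain ⟨S, hS0, hS⟩ := exists_le_pinskerSum hp hβ hq c
  obtain ⟨N, hN⟩ := exists_pinskerSum_eq_sum hβ hq S
  have hcont : ContinuousOn (pinskerSum β q) (Set.Icc 0 S) := by
    refine ContinuousOn.congr (f := fun s => ∑ i ∈ Finset.range N, sobolevCoeff β (i + 1) *
      ∑ j, max 0 (s - sobolevCoeff β (i + 1) * (q j)⁻¹)) ?_ fun s hs => hN s hs.2
    fun_prop
  obtain ⟨s, hs, hsc⟩ := intermediate_value_Icc hS0 hcont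
    (show c ∈ Set.Icc _ _ from ⟨by rw [pinskerSum_zero hq]; exact hc.le, hS⟩)
  have hs0 : 0 < s := by
    rcases hs.1.eq_or_lt with h | h
    · rw [← h, pinskerSum_zero hq] at hsc; exact absurd hsc hc.ne
    · exact h
  refine ⟨s, ⟨hs0, hsc⟩, fun t ht => ?_⟩
  rcases lt_trichotomy t s with h | h | h
  · have := pinskerSum_lt hβ hq h (by rw [ht.2]; exact hc)
    rw [ht.2, hsc] at this; exact absurd this (lt_irrefl _)
  · exact h
  · have := pinskerSum_lt hβ hq h (by rw [hsc]; exact hc)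
    rw [ht.2, hsc] at this; exact absurd this (lt_irrefl _)

/-- The solutions `κ` of `ε² ∑ᵢ a_{β,i+1} ∑ⱼ (κ⁻¹ - a_{β,i+1} / qⱼ)₊ = 1` tend to zero with `ε`. -/
theorem tendsto_pinskerRoot_zero (hβ : 0 < β) (hq : ∀ j, 0 < q j) {κ : ℝ → ℝ}
    (hκ : ∀ ε, 0 < ε → 0 < κ ε ∧ ε ^ 2 * pinskerSum β q (κ ε)⁻¹ = 1) :
    Tendsto κ (𝓝[>] 0) (𝓝[>] 0) := by
  refine tendsto_nhdsWithin_iff.2 ⟨?_, ?_⟩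
  · refine (tendsto_order.2 ⟨fun b hb => ?_, fun b hb => ?_⟩)
    · filter_upwards [self_mem_nhdsWithin] with ε hε using hb.trans (hκ ε hε).1
    · have h : Tendsto (fun ε : ℝ => ε ^ 2 * pinskerSum β q b⁻¹) (𝓝[>] 0) (𝓝 0) := by
        have : Continuous fun ε : ℝ => ε ^ 2 * pinskerSum β q b⁻¹ := by fun_prop
        simpa using (this.tendsto 0).mono_left nhdsWithin_le_nhds
      filter_upwards [self_mem_nhdsWithin, h.eventually_lt_const one_pos] with ε hε h1
      obtain ⟨h2, h3⟩ := hκ ε hε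
      -- If `b ≤ κ ε`, monotonicity gives `1 ≤ ε² * pinskerSum β q b⁻¹`, which is below `1` for
      -- small `ε`.
      by_contra! hle
      have := pinskerSum_mono hβ hq (inv_anti₀ hb hle)
      nlinarith [sq_nonneg ε]
  · filter_upwards [self_mem_nhdsWithin] with ε hε using (hκ ε hε).1

end MPinsker

end

/-! ### Rotation to the eigenbasis of `Q`. -/

noncomputable section

namespace MPinsker

variable {p : ℕ} {β : ℝ} {Q U : Matrix (Fin p) (Fin p) ℝ} {q : Fin p → ℝ}

/-- `Q = U diag(q) Uᵀ` with `U` orthogonal and `q` positive, together with the induced form of the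
functional calculus of `Q`. -/
structure IsDiagonalization (Q U : Matrix (Fin p) (Fin p) ℝ) (q : Fin p → ℝ) : Prop where
  pos : ∀ j, 0 < q j
  mul_transpose : U * Uᵀ = 1
  transpose_mul : Uᵀ * U = 1
  cfc_eq : ∀ f : ℝ → ℝ, cfc f Q = U * Matrix.diagonal (fun j => f (q j)) * Uᵀ

theorem exists_isDiagonalization (hQ : Q.PosDef) : ∃ U q, IsDiagonalization Q U q := by
  refine ⟨hQ.isHermitian.eigenvectorUnitary, hQ.isHermitian.eigenvalues,
    hQ.eigenvalues_pos, ?_, ?_, fun f => ?_⟩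
  · exact Unitary.coe_mul_star_self hQ.isHermitian.eigenvectorUnitary
  · exact Unitary.coe_star_mul_self hQ.isHermitian.eigenvectorUnitary
  · rw [hQ.isHermitian.cfc_eq, Matrix.IsHermitian.cfc, Unitary.conjStarAlgAut_apply]
    rfl

namespace IsDiagonalization

lemma diag_mul_diag (h : IsDiagonalization Q U q) (d e : Fin p → ℝ) :
    (U * Matrix.diagonal d * Uᵀ) * (U * Matrix.diagonal e * Uᵀ)
      = U * Matrix.diagonal (fun j => d j * e j) * Uᵀ := by
  calc _ = U * Matrix.diagonal d * (Uᵀ * U) * Matrix.diagonal e * Uᵀ := by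
        simp only [Matrix.mul_assoc]
    _ = _ := by
        rw [h.transpose_mul, Matrix.mul_one, Matrix.mul_assoc U, Matrix.diagonal_mul_diagonal]

lemma trace_diag (h : IsDiagonalization Q U q) (d : Fin p → ℝ) :
    (U * Matrix.diagonal d * Uᵀ).trace = ∑ j, d j := by
  rw [Matrix.trace_mul_comm, ← Matrix.mul_assoc, h.transpose_mul, Matrix.one_mul,
    Matrix.trace_diagonal]

lemma quadForm_diag (U : Matrix (Fin p) (Fin p) ℝ) (d : Fin p → ℝ) (x : Fin p → ℝ) :
    quadForm (U * Matrix.diagonal d * Uᵀ) x = ∑ j, d j * (Uᵀ *ᵥ x) j ^ 2 := by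
  unfold quadForm
  rw [← Matrix.mulVec_mulVec, ← Matrix.mulVec_mulVec, Matrix.dotProduct_mulVec,
    ← Matrix.mulVec_transpose]
  simp only [dotProduct, Matrix.mulVec_diagonal]
  exact Finset.sum_congr rfl fun j _ => by ring

lemma eq_diag (h : IsDiagonalization Q U q) (hQ : Q.PosDef) :
    Q = U * Matrix.diagonal q * Uᵀ := by
  have := h.cfc_eq id
  rwa [cfc_id ℝ Q hQ.isHermitian.isSelfAdjoint] at this

lemma inv_eq_diag (h : IsDiagonalization Q U q) (hQ : Q.PosDef) :
    Q⁻¹ = U * Matrix.diagonal (fun j => (q j)⁻¹) * Uᵀ := by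
  refine Matrix.inv_eq_right_inv ?_
  conv_lhs => rw [h.eq_diag hQ]
  rw [h.diag_mul_diag]
  have : (fun j => q j * (q j)⁻¹) = fun _ => (1 : ℝ) :=
    funext fun j => mul_inv_cancel₀ (h.pos j).ne'
  rw [this, Matrix.diagonal_one, Matrix.mul_one, h.mul_transpose]

/-- The matrix `(1 - aκQ⁻¹)₊` is a single function of `Q`, obtained by composing two functional
calculi. Continuity is automatic on a finite spectrum, even for `x⁻¹`. -/
lemma pinskerCoeff_eq (h : IsDiagonalization Q U q) (hQ : Q.PosDef) (κ : ℝ) (i : ℕ) :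
    pinskerCoeff β Q κ i = U * Matrix.diagonal (fun j => pinskerWeight β (q j) κ i) * Uᵀ := by
  have hfin : ∀ (f : ℝ → ℝ) (s : Set ℝ), s.Finite → ContinuousOn f s :=
    fun f s hs => hs.continuousOn f
  have e : (1 : Matrix (Fin p) (Fin p) ℝ) - (sobolevCoeff β (i + 1) * κ) • Q⁻¹
      = cfc (fun x : ℝ => 1 - sobolevCoeff β (i + 1) * κ * x⁻¹) Q := by
    rw [h.cfc_eq, h.inv_eq_diag hQ]
    conv_lhs => rw [← h.mul_transpose]
    rw [← Matrix.smul_mul, ← Matrix.mul_smul, ← Matrix.diagonal_smul, ← Matrix.sub_mul]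
    congr 1
    conv_lhs => rw [← Matrix.mul_one U]
    rw [Matrix.mul_assoc U 1, Matrix.one_mul, ← Matrix.mul_sub, ← Matrix.diagonal_one,
      Matrix.diagonal_sub]
    rfl
  unfold pinskerCoeff matPosPart
  rw [e, ← cfc_comp' (fun x : ℝ => max 0 x) _ Q
    (hfin _ _ (Q.finite_real_spectrum.image _)) (hfin _ _ Q.finite_real_spectrum)
    hQ.isHermitian.isSelfAdjoint, h.cfc_eq]
  rfl

lemma trace_matRpow (h : IsDiagonalization Q U q) (r : ℝ) :
    (matRpow Q r).trace = ∑ j, q j ^ r := by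
  unfold matRpow
  rw [h.cfc_eq, h.trace_diag]

lemma trace_pinskerCoeff (h : IsDiagonalization Q U q) (hQ : Q.PosDef) (κ : ℝ) (i : ℕ) :
    (pinskerCoeff β Q κ i).trace = ∑ j, pinskerWeight β (q j) κ i := by
  rw [h.pinskerCoeff_eq hQ, h.trace_diag]

lemma isPinskerRoot_iff (h : IsDiagonalization Q U q) (hQ : Q.PosDef) (ε κ : ℝ) :
    IsPinskerRoot β Q ε κ ↔ 0 < κ ∧ ε ^ 2 * pinskerSum β q κ⁻¹ = 1 := by
  unfold IsPinskerRoot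
  refine and_congr_right fun hκ => ?_
  simp only [h.trace_pinskerCoeff hQ]
  rw [mul_assoc, inv_mul_tsum_eq_pinskerSum hκ]

theorem existsUnique_isPinskerRoot (h : IsDiagonalization Q U q) (hQ : Q.PosDef) (hp : 0 < p)
    (hβ : 0 < β) {ε : ℝ} (hε : 0 < ε) : ∃! κ, IsPinskerRoot β Q ε κ := by
  obtain ⟨s, ⟨hs, hs'⟩, huniq⟩ := existsUnique_pinskerSum_eq hp hβ h.pos
    (c := (ε ^ 2)⁻¹) (by positivity)
  refine ⟨s⁻¹, ?_, fun κ hκ => ?_⟩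
  · simp only [h.isPinskerRoot_iff hQ, inv_inv, hs']
    exact ⟨by positivity, mul_inv_cancel₀ (by positivity)⟩
  · replace hκ := (h.isPinskerRoot_iff hQ _ _).1 hκ
    rw [← huniq κ⁻¹ ⟨inv_pos.2 hκ.1, eq_inv_of_mul_eq_one_right hκ.2⟩, inv_inv]

end IsDiagonalization

/-- Multiplication of every vector of a sequence by a matrix. -/
def mulVecSeq (A : Matrix (Fin p) (Fin p) ℝ) (x : Seq p) : Seq p := fun i => A *ᵥ x i

@[fun_prop]
lemma measurable_mulVecSeq (A : Matrix (Fin p) (Fin p) ℝ) : Measurable (mulVecSeq A) := by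
  refine measurable_pi_iff.2 fun i => measurable_pi_iff.2 fun j => ?_
  simp only [mulVecSeq, Matrix.mulVec, dotProduct]
  fun_prop

instance : IsProbabilityMeasure (noiseLaw p) := by
  unfold noiseLaw; infer_instance

/-- An orthogonal matrix is a linear isometry of Euclidean space, and the standard Gaussian is
invariant under isometries. The statement is transported through `WithLp.toLp 2`. -/
lemma map_mulVec_pi_gaussianReal (h : Uᵀ * U = 1) :
    (Measure.pi fun _ : Fin p => gaussianReal 0 1).map (fun x => U *ᵥ x)
      = Measure.pi fun _ : Fin p => gaussianReal 0 1 := by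
  have hm : Measurable fun x : Fin p → ℝ => U *ᵥ x := by
    refine measurable_pi_iff.2 fun j => ?_
    simp only [Matrix.mulVec, dotProduct]
    fun_prop
  have hU : U ∈ Matrix.orthogonalGroup (Fin p) ℝ := (Matrix.mem_orthogonalGroup_iff' _ _).2 h
  let e : EuclideanSpace ℝ (Fin p) ≃ₗᵢ[ℝ] EuclideanSpace ℝ (Fin p) :=
    Unitary.linearIsometryEquiv ⟨Matrix.toEuclideanCLM (𝕜 := ℝ) U, Unitary.map_mem _ hU⟩
  have he : (WithLp.toLp 2 : (Fin p → ℝ) → EuclideanSpace ℝ (Fin p)) ∘ (fun x => U *ᵥ x)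
      = e ∘ WithLp.toLp 2 := rfl
  apply (MeasurableEquiv.toLp 2 (Fin p → ℝ)).map_measurableEquiv_injective
  change Measure.map (WithLp.toLp 2) _ = Measure.map (WithLp.toLp 2) _
  rw [Measure.map_map (by fun_prop) hm, he, ← Measure.map_map (by fun_prop) (by fun_prop),
    map_pi_eq_stdGaussian, stdGaussian_map]

/-- The noise law is invariant under orthogonal transformations of every vector. -/
lemma measurePreserving_mulVecSeq_noiseLaw (h : Uᵀ * U = 1) :
    MeasurePreserving (mulVecSeq U) (noiseLaw p) (noiseLaw p) := by
  refine ⟨measurable_mulVecSeq U, ?_⟩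
  have hm : Measurable fun x : Fin p → ℝ => U *ᵥ x := by
    refine measurable_pi_iff.2 fun j => ?_
    simp only [Matrix.mulVec, dotProduct]
    fun_prop
  unfold noiseLaw mulVecSeq
  rw [Measure.infinitePi_map_pi _ (f := fun _ x => U *ᵥ x) (fun _ => hm)]
  simp only [map_mulVec_pi_gaussianReal h]

/-- The loss in the coordinates of an eigenbasis of `Q`. -/
def diagLoss (q : Fin p → ℝ) (θ t : Seq p) : ℝ≥0∞ :=
  ∑' i, ENNReal.ofReal (∑ j, q j * (t i j - θ i j) ^ 2)

/-- The Sobolev ellipsoid in the coordinates of an eigenbasis of `Q`. -/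
def diagEllipsoid (β : ℝ) (q : Fin p → ℝ) : Set (Seq p) :=
  {θ | ∑' i, ENNReal.ofReal (sobolevCoeff β (i + 1) ^ 2 * ∑ j, (q j)⁻¹ * θ i j ^ 2) ≤ 1}

/-- The risk in the coordinates of an eigenbasis of `Q`. -/
def diagRisk (q : Fin p → ℝ) (ε : ℝ) (θ : Seq p) (f : Seq p → Seq p) : ℝ≥0∞ :=
  ∫⁻ ξ, diagLoss q θ (f (fun i j => θ i j + ε * ξ i j)) ∂(noiseLaw p)

lemma measurable_diagLoss {α : Type*} [MeasurableSpace α] (q : Fin p → ℝ) {f g : α → Seq p}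
    (hf : Measurable f) (hg : Measurable g) : Measurable fun a => diagLoss q (f a) (g a) := by
  have hf' : ∀ i j, Measurable fun a => f a i j := fun i j =>
    measurable_pi_iff.1 (measurable_pi_iff.1 hf i) j
  have hg' : ∀ i j, Measurable fun a => g a i j := fun i j =>
    measurable_pi_iff.1 (measurable_pi_iff.1 hg i) j
  unfold diagLoss
  exact Measurable.tsum fun i => ENNReal.measurable_ofReal.comp
    (Finset.measurable_sum _ fun j _ => (((hg' i j).sub (hf' i j)).pow_const 2).const_mul _)

namespace IsDiagonalization

lemma mulVecSeq_transpose_mulVecSeq (h : IsDiagonalization Q U q) (x : Seq p) :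
    mulVecSeq Uᵀ (mulVecSeq U x) = x := by
  funext i; simp [mulVecSeq, h.transpose_mul]

lemma loss_eq (h : IsDiagonalization Q U q) (hQ : Q.PosDef) (θ t : Seq p) :
    loss Q θ t = diagLoss q (mulVecSeq Uᵀ θ) (mulVecSeq Uᵀ t) := by
  unfold loss diagLoss
  refine tsum_congr fun i => ?_
  conv_lhs => rw [h.eq_diag hQ]
  rw [quadForm_diag, Matrix.mulVec_sub]
  rfl

lemma mem_sobolevEllipsoid_iff (h : IsDiagonalization Q U q) (hQ : Q.PosDef) (θ : Seq p) :
    θ ∈ sobolevEllipsoid β Q ↔ mulVecSeq Uᵀ θ ∈ diagEllipsoid β q := by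
  unfold sobolevEllipsoid diagEllipsoid
  simp only [h.inv_eq_diag hQ, quadForm_diag]
  rfl

/-- The noise `ξ` may be replaced by `Uξ`, and `θ + εUξ = U(Uᵀθ + εξ)`. An estimator thus
corresponds to its conjugate by `U`. -/
lemma risk_eq (h : IsDiagonalization Q U q) (hQ : Q.PosDef) (ε : ℝ) (θ : Seq p)
    (f : Estimator p) :
    risk Q ε θ f = diagRisk q ε (mulVecSeq Uᵀ θ) (fun y => mulVecSeq Uᵀ (f.1 (mulVecSeq U y))) := by
  have hf := f.2
  have hshift : Measurable fun ξ : Seq p => fun i => θ i + ε • ξ i := by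
    refine measurable_pi_iff.2 fun i => measurable_pi_iff.2 fun j => ?_
    simp only [Pi.add_apply, Pi.smul_apply]
    fun_prop
  have hmeas : Measurable fun y : Seq p => diagLoss q (mulVecSeq Uᵀ θ) (mulVecSeq Uᵀ (f.1 y)) :=
    measurable_diagLoss q measurable_const ((measurable_mulVecSeq Uᵀ).comp hf)
  have key : ∀ ξ : Seq p, (fun i => θ i + ε • mulVecSeq U ξ i)
      = mulVecSeq U (fun i j => mulVecSeq Uᵀ θ i j + ε * ξ i j) := fun ξ => by
    funext i
    have : (fun j => (Uᵀ *ᵥ θ i) j + ε * ξ i j) = Uᵀ *ᵥ θ i + ε • ξ i := rfl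
    simp only [mulVecSeq]
    rw [this, Matrix.mulVec_add, Matrix.mulVec_smul, Matrix.mulVec_mulVec, h.mul_transpose,
      Matrix.one_mulVec]
  calc risk Q ε θ f
      = ∫⁻ y, diagLoss q (mulVecSeq Uᵀ θ) (mulVecSeq Uᵀ (f.1 y))
          ∂((noiseLaw p).map fun ξ i => θ i + ε • ξ i) := by
        unfold risk observationLaw
        exact lintegral_congr fun y => h.loss_eq hQ _ _
    _ = ∫⁻ ξ, diagLoss q (mulVecSeq Uᵀ θ) (mulVecSeq Uᵀ (f.1 fun i => θ i + ε • ξ i))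
          ∂(noiseLaw p) := by
        rw [lintegral_map hmeas hshift]
    _ = ∫⁻ ξ, diagLoss q (mulVecSeq Uᵀ θ)
          (mulVecSeq Uᵀ (f.1 fun i => θ i + ε • mulVecSeq U ξ i)) ∂(noiseLaw p) := by
        rw [← (measurePreserving_mulVecSeq_noiseLaw h.transpose_mul).lintegral_comp
          (f := fun ξ => diagLoss q (mulVecSeq Uᵀ θ) (mulVecSeq Uᵀ (f.1 fun i => θ i + ε • ξ i)))
          (hmeas.comp hshift)]
    _ = _ := by
        exact lintegral_congr fun ξ => by rw [key]

lemma mulVec_pinskerCoeff (h : IsDiagonalization Q U q) (hQ : Q.PosDef) (κ : ℝ) (y : Seq p) :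
    mulVecSeq Uᵀ ((linearEstimator (pinskerCoeff β Q κ)).1 (mulVecSeq U y))
      = fun i j => pinskerWeight β (q j) κ i * y i j := by
  funext i j
  simp only [linearEstimator, mulVecSeq, h.pinskerCoeff_eq hQ, Matrix.mulVec_mulVec]
  have : Uᵀ * (U * Matrix.diagonal (fun j => pinskerWeight β (q j) κ i) * Uᵀ * U)
      = Matrix.diagonal (fun j => pinskerWeight β (q j) κ i) := by
    rw [Matrix.mul_assoc _ Uᵀ U, h.transpose_mul, Matrix.mul_one, ← Matrix.mul_assoc,
      h.transpose_mul, Matrix.one_mul]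
  rw [this, Matrix.mulVec_diagonal]

end IsDiagonalization

end MPinsker

end

/-! ### Gaussian coordinates, the Bayes risk of one coordinate, and second moments. -/

noncomputable section

namespace MPinsker

variable {p : ℕ} {β : ℝ} {q : Fin p → ℝ}

lemma measurable_coord (k : ℕ × Fin p) : Measurable fun ξ : Seq p => ξ k.1 k.2 :=
  (measurable_pi_apply k.2).comp (measurable_pi_apply k.1)

lemma hasLaw_coord (k : ℕ × Fin p) :
    HasLaw (fun ξ : Seq p => ξ k.1 k.2) (gaussianReal 0 1) (noiseLaw p) := by
  refine ⟨(measurable_coord k).aemeasurable, ?_⟩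
  have h : (fun ξ : Seq p => ξ k.1 k.2) =
      (fun x : Fin p → ℝ => x k.2) ∘ fun ξ : Seq p => ξ k.1 := rfl
  rw [h, ← Measure.map_map (measurable_pi_apply _) (measurable_pi_apply _), noiseLaw,
    Measure.infinitePi_map_eval,
    (measurePreserving_eval (fun _ : Fin p => gaussianReal 0 1) k.2).map_eq]

lemma iIndepFun_coord :
    iIndepFun (fun (k : ℕ × Fin p) (ξ : Seq p) => ξ k.1 k.2) (noiseLaw p) := by
  have := iIndepFun_uncurry_infinitePi' (ι := ℕ) (κ := Fin p) (Ω := fun _ _ => ℝ)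
    (X := fun _ _ x => x) (fun _ _ => gaussianReal 0 1) (fun _ _ => measurable_id)
  simp only [Measure.infinitePi_eq_pi] at this
  exact this

lemma isGaussianProcess_coord :
    IsGaussianProcess (fun (k : ℕ × Fin p) (ξ : Seq p) => ξ k.1 k.2) (noiseLaw p) where
  hasGaussianLaw I := iIndepFun.hasGaussianLaw (fun k : I => (hasLaw_coord k.1).hasGaussianLaw)
    (iIndepFun_coord.precomp Subtype.val_injective)

lemma memLp_coord (k : ℕ × Fin p) : MemLp (fun ξ : Seq p => ξ k.1 k.2) 2 (noiseLaw p) :=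
  (hasLaw_coord k).hasGaussianLaw.memLp_two

lemma covariance_coord (k l : ℕ × Fin p) :
    cov[fun ξ : Seq p => ξ k.1 k.2, fun ξ : Seq p => ξ l.1 l.2; noiseLaw p]
      = if k = l then 1 else 0 := by
  split_ifs with h
  · subst h
    rw [covariance_self (measurable_coord k).aemeasurable, (hasLaw_coord k).variance_eq]
    simp
  · exact (iIndepFun_coord.indepFun h).covariance_eq_zero (memLp_coord k) (memLp_coord l)

/-- Two independent Gaussian processes are jointly Gaussian. -/
lemma isGaussianProcess_sumElim_prod {Ω Ω' S T : Type*} [MeasurableSpace Ω] [MeasurableSpace Ω']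
    {P : Measure Ω} {P' : Measure Ω'} {X : S → Ω → ℝ} {Y : T → Ω' → ℝ}
    (hX : IsGaussianProcess X P) (hY : IsGaussianProcess Y P') :
    IsGaussianProcess (Sum.elim (fun s (ω : Ω × Ω') => X s ω.1) (fun t ω => Y t ω.2))
      (P.prod P') where
  hasGaussianLaw I := by
    have := hX.isProbabilityMeasure
    have := hY.isProbabilityMeasure
    have h1 := hX.hasGaussianLaw I.toLeft
    have h2 := hY.hasGaussianLaw I.toRight
    have h1' : HasGaussianLaw (fun ω : Ω × Ω' => I.toLeft.restrict (X · ω.1)) (P.prod P') := by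
      refine ⟨?_⟩
      have e := AEMeasurable.map_map_of_aemeasurable (μ := P.prod P') (f := Prod.fst)
        (g := fun ω => I.toLeft.restrict (X · ω))
        (by rw [measurePreserving_fst.map_eq]; exact h1.aemeasurable) measurable_fst.aemeasurable
      rw [measurePreserving_fst.map_eq] at e
      have := h1.isGaussian_map
      rw [e] at this
      exact this
    have h2' : HasGaussianLaw (fun ω : Ω × Ω' => I.toRight.restrict (Y · ω.2)) (P.prod P') := by
      refine ⟨?_⟩
      have e := AEMeasurable.map_map_of_aemeasurable (μ := P.prod P') (f := Prod.snd)
        (g := fun ω => I.toRight.restrict (Y · ω))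
        (by rw [measurePreserving_snd.map_eq]; exact h2.aemeasurable) measurable_snd.aemeasurable
      rw [measurePreserving_snd.map_eq] at e
      have := h2.isGaussian_map
      rw [e] at this
      exact this
    have hind := indepFun_prod₀ (μ := P) (ν := P') h1.aemeasurable h2.aemeasurable
    let f : (I.toLeft → ℝ) × (I.toRight → ℝ) → (u : S ⊕ T) → u ∈ I → ℝ := fun x u =>
      match u with
      | .inl s => fun h => x.1 ⟨s, Finset.mem_toLeft.2 h⟩
      | .inr t => fun h => x.2 ⟨t, Finset.mem_toRight.2 h⟩
    let L : ((I.toLeft → ℝ) × (I.toRight → ℝ)) →L[ℝ] (I → ℝ) :=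
      LinearMap.toContinuousLinearMap
      { toFun := fun x u => f x u.1 u.2
        map_add' := fun x y => by
          funext ⟨u, hu⟩
          rcases u with s | t <;> rfl
        map_smul' := fun c x => by
          funext ⟨u, hu⟩
          rcases u with s | t <;> rfl }
    refine ((hind.hasGaussianLaw h1' h2').map L).congr (Eventually.of_forall fun ω => ?_)
    funext ⟨u, hu⟩
    rcases u with s | t <;> rfl

/-- Linear combination of a coordinate of the signal variable and of the noise variable. -/
def comb (a b : ℝ) (k : ℕ × Fin p) (ω : Seq p × Seq p) : ℝ := a * ω.1 k.1 k.2 + b * ω.2 k.1 k.2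

lemma measurable_comb (a b : ℝ) (k : ℕ × Fin p) : Measurable (comb a b k) :=
  (((measurable_coord k).comp measurable_fst).const_mul a).add
    (((measurable_coord k).comp measurable_snd).const_mul b)

lemma covariance_comb (a b c d : ℝ) (k l : ℕ × Fin p) :
    cov[comb a b k, comb c d l; (noiseLaw p).prod (noiseLaw p)]
      = if k = l then a * c + b * d else 0 := by
  have m1 : ∀ k : ℕ × Fin p, MemLp (fun ω : Seq p × Seq p => ω.1 k.1 k.2) 2
      ((noiseLaw p).prod (noiseLaw p)) := fun k =>
    (memLp_coord k).comp_measurePreserving measurePreserving_fst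
  have m2 : ∀ k : ℕ × Fin p, MemLp (fun ω : Seq p × Seq p => ω.2 k.1 k.2) 2
      ((noiseLaw p).prod (noiseLaw p)) := fun k =>
    (memLp_coord k).comp_measurePreserving measurePreserving_snd
  have c1 : cov[fun ω : Seq p × Seq p => ω.1 k.1 k.2, fun ω => ω.1 l.1 l.2;
      (noiseLaw p).prod (noiseLaw p)] = if k = l then 1 else 0 := by
    rw [← covariance_coord k l]
    conv_rhs => rw [← (measurePreserving_fst (μ := noiseLaw p) (ν := noiseLaw p)).map_eq]
    rw [covariance_map_fun (measurable_coord k).aestronglyMeasurable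
      (measurable_coord l).aestronglyMeasurable measurable_fst.aemeasurable]
  have c2 : cov[fun ω : Seq p × Seq p => ω.2 k.1 k.2, fun ω => ω.2 l.1 l.2;
      (noiseLaw p).prod (noiseLaw p)] = if k = l then 1 else 0 := by
    rw [← covariance_coord k l]
    conv_rhs => rw [← (measurePreserving_snd (μ := noiseLaw p) (ν := noiseLaw p)).map_eq]
    rw [covariance_map_fun (measurable_coord k).aestronglyMeasurable
      (measurable_coord l).aestronglyMeasurable measurable_snd.aemeasurable]
  have c3 : cov[fun ω : Seq p × Seq p => ω.1 k.1 k.2, fun ω => ω.2 l.1 l.2;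
      (noiseLaw p).prod (noiseLaw p)] = 0 :=
    (indepFun_prod (measurable_coord k) (measurable_coord l)).covariance_eq_zero (m1 k) (m2 l)
  have c4 : cov[fun ω : Seq p × Seq p => ω.2 k.1 k.2, fun ω => ω.1 l.1 l.2;
      (noiseLaw p).prod (noiseLaw p)] = 0 :=
    (indepFun_prod (measurable_coord l) (measurable_coord k)).symm.covariance_eq_zero (m2 k) (m1 l)
  have e1 : comb a b k = (fun ω : Seq p × Seq p => a * ω.1 k.1 k.2)
      + fun ω => b * ω.2 k.1 k.2 := rfl
  have e2 : comb c d l = (fun ω : Seq p × Seq p => c * ω.1 l.1 l.2)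
      + fun ω => d * ω.2 l.1 l.2 := rfl
  rw [e1, e2, covariance_add_left ((m1 k).const_mul a) ((m2 k).const_mul b)
    (((m1 l).const_mul c).add ((m2 l).const_mul d)),
    covariance_add_right ((m1 k).const_mul a) ((m1 l).const_mul c) ((m2 l).const_mul d),
    covariance_add_right ((m2 k).const_mul b) ((m1 l).const_mul c) ((m2 l).const_mul d)]
  simp only [covariance_const_mul_left, covariance_const_mul_right, c1, c2, c3, c4]
  split_ifs <;> ring

lemma isGaussianProcess_comb {S : Type*} (a b : S → ℝ) (k : S → ℕ × Fin p) :
    IsGaussianProcess (fun s => comb (a s) (b s) (k s)) ((noiseLaw p).prod (noiseLaw p)) := by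
  classical
  refine IsGaussianProcess.of_isGaussianProcess (isGaussianProcess_sumElim_prod
    isGaussianProcess_coord isGaussianProcess_coord) fun s => ⟨{.inl (k s), .inr (k s)},
      LinearMap.toContinuousLinearMap
      { toFun := fun x => a s * x ⟨.inl (k s), by simp⟩ + b s * x ⟨.inr (k s), by simp⟩
        map_add' := fun x y => by simp; ring
        map_smul' := fun c x => by simp; ring }, fun ω => rfl⟩

/-- Signal plus noise, with signal standard deviations `τ` and noise level `ε`. -/
def observe (τ : Seq p) (ε : ℝ) (ω : Seq p × Seq p) : Seq p :=
  fun i j => τ i j * ω.1 i j + ε * ω.2 i j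

/-- The mean is the best constant predictor. This is applied with the observation held fixed, when
an estimate is a constant. -/
lemma variance_le_lintegral_sq_sub {Ω : Type*} [MeasurableSpace Ω] {P : Measure Ω}
    [IsProbabilityMeasure P] {X : Ω → ℝ} (hX : MemLp X 2 P) (c : ℝ) :
    ENNReal.ofReal Var[X; P] ≤ ∫⁻ ω, ENNReal.ofReal ((c - X ω) ^ 2) ∂P := by
  have hm : MemLp (fun ω => X ω - c) 2 P := hX.sub (memLp_const c)
  have e : ∀ ω, (c - X ω) ^ 2 = (X ω - c) ^ 2 := fun ω => by ring
  simp only [e]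
  rw [← ofReal_integral_eq_lintegral_ofReal hm.integrable_sq
    (Eventually.of_forall fun ω => sq_nonneg _)]
  refine ENNReal.ofReal_le_ofReal ?_
  rw [← variance_sub_const hX.aestronglyMeasurable c]
  exact variance_le_expectation_sq hm.aestronglyMeasurable

/-- Bayes risk of one coordinate under a Gaussian prior: no estimator is better than the linear
one. -/
theorem bayes_risk_coord (τ : Seq p) {ε : ℝ} (hε : 0 < ε) (k : ℕ × Fin p) {T : Seq p → ℝ}
    (hT : Measurable T) :
    ENNReal.ofReal (ε ^ 2 * τ k.1 k.2 ^ 2 / (ε ^ 2 + τ k.1 k.2 ^ 2))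
      ≤ ∫⁻ ω, ENNReal.ofReal ((T (observe τ ε ω) - τ k.1 k.2 * ω.1 k.1 k.2) ^ 2)
        ∂((noiseLaw p).prod (noiseLaw p)) := by
  set P := (noiseLaw p).prod (noiseLaw p)
  set t := τ k.1 k.2
  have hd : ε ^ 2 + t ^ 2 ≠ 0 := by positivity
  -- `w` is the weight of the linear Bayes rule. The numbers `a = t - wt` and `b = -wε` make `comb a
  -- b k` its residual: the signal minus `w` times the observation.
  set w := t ^ 2 / (ε ^ 2 + t ^ 2) with hw
  set a := ε ^ 2 * t / (ε ^ 2 + t ^ 2) with ha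
  set b := -(ε * t ^ 2 / (ε ^ 2 + t ^ 2)) with hb
  let X : Unit → Seq p × Seq p → ℝ := fun _ => comb a b k
  let Y : ℕ × Fin p → Seq p × Seq p → ℝ := fun l => comb (τ l.1 l.2) ε l
  have hG : IsGaussianProcess (Sum.elim X Y) P := by
    have := isGaussianProcess_comb (p := p) (S := Unit ⊕ (ℕ × Fin p))
      (Sum.elim (fun _ => a) fun l => τ l.1 l.2) (Sum.elim (fun _ => b) fun _ => ε)
      (Sum.elim (fun _ => k) id)
    convert this using 1
    funext s
    rcases s with s | s <;> rfl
  -- The residual is uncorrelated with every observed coordinate, since `a t + b ε = 0` at `k`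
  -- itself. Joint Gaussianity upgrades this to independence from the whole observation.
  have hind : IndepFun (fun ω s => X s ω) (fun ω l => Y l ω) P := by
    refine hG.indepFun_of_covariance_eq_zero (fun _ => (measurable_comb _ _ _).aemeasurable)
      (fun _ => (measurable_comb _ _ _).aemeasurable) fun s l => ?_
    simp only [X, Y, P]
    rw [covariance_comb]
    split_ifs with h
    · subst h
      rw [ha, hb]
      field_simp
      ring
    · rfl
  have hmX : MemLp (comb a b k) 2 P := (hG.hasGaussianLaw_eval (.inl ())).memLp_two
  have hvar : Var[comb a b k; P] = ε ^ 2 * t ^ 2 / (ε ^ 2 + t ^ 2) := by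
    rw [← covariance_self (measurable_comb _ _ _).aemeasurable, covariance_comb, if_pos rfl, ha, hb]
    field_simp
  have hobs : Measurable (observe (p := p) τ ε) :=
    measurable_pi_iff.2 fun i => measurable_pi_iff.2 fun j => measurable_comb _ _ (i, j)
  have hindep : IndepFun (comb a b k) (observe τ ε) P := by
    refine hind.comp (φ := fun x : Unit → ℝ => x ())
      (ψ := fun y : ℕ × Fin p → ℝ => fun i j => y (i, j))
      (measurable_pi_apply _) ?_
    exact measurable_pi_iff.2 fun i => measurable_pi_iff.2 fun j => measurable_pi_apply _
  have hlaw := (indepFun_iff_map_prod_eq_prod_map_map (measurable_comb _ _ _).aemeasurable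
    hobs.aemeasurable).1 hindep
  have hH : Measurable fun y : Seq p => T y - w * y k.1 k.2 :=
    hT.sub ((measurable_coord k).const_mul w)
  have hF : Measurable fun z : ℝ × Seq p =>
      ENNReal.ofReal ((T z.2 - w * z.2 k.1 k.2 - z.1) ^ 2) :=
    ENNReal.measurable_ofReal.comp (((hH.comp measurable_snd).sub measurable_fst).pow_const 2)
  have : IsProbabilityMeasure (P.map (observe τ ε)) :=
    Measure.isProbabilityMeasure_map hobs.aemeasurable
  calc ENNReal.ofReal (ε ^ 2 * t ^ 2 / (ε ^ 2 + t ^ 2))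
      = ∫⁻ _, ENNReal.ofReal Var[comb a b k; P] ∂(P.map (observe τ ε)) := by
        rw [lintegral_const, measure_univ, mul_one, hvar]
    _ ≤ ∫⁻ y, ∫⁻ x, ENNReal.ofReal ((T y - w * y k.1 k.2 - x) ^ 2) ∂(P.map (comb a b k))
          ∂(P.map (observe τ ε)) := by
        refine lintegral_mono fun y => ?_
        rw [lintegral_map (f := fun x => ENNReal.ofReal ((T y - w * y k.1 k.2 - x) ^ 2))
          (by fun_prop) (measurable_comb _ _ _)]
        exact variance_le_lintegral_sq_sub hmX _
    _ = ∫⁻ z, ENNReal.ofReal ((T z.2 - w * z.2 k.1 k.2 - z.1) ^ 2)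
          ∂(P.map fun ω => (comb a b k ω, observe τ ε ω)) := by
        rw [hlaw, lintegral_prod_symm _ hF.aemeasurable]
    _ = _ := by
        rw [lintegral_map hF ((measurable_comb _ _ _).prodMk hobs)]
        refine lintegral_congr fun ω => ?_
        congr 2
        simp only [comb, observe, hw, ha, hb]
        field_simp
        ring

lemma integral_coord (k : ℕ × Fin p) : ∫ ξ : Seq p, ξ k.1 k.2 ∂(noiseLaw p) = 0 := by
  rw [(hasLaw_coord k).integral_eq]; simp

lemma integral_coord_sq (k : ℕ × Fin p) : ∫ ξ : Seq p, ξ k.1 k.2 ^ 2 ∂(noiseLaw p) = 1 := by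
  have := (hasLaw_coord k).variance_eq
  rw [variance_of_integral_eq_zero (measurable_coord k).aemeasurable (integral_coord k)] at this
  simpa using this

lemma lintegral_sq_affine_coord (a b : ℝ) (k : ℕ × Fin p) :
    ∫⁻ ξ, ENNReal.ofReal ((a + b * ξ k.1 k.2) ^ 2) ∂(noiseLaw p)
      = ENNReal.ofReal (a ^ 2 + b ^ 2) := by
  have hm := memLp_coord k
  have hi := hm.integrable_sq
  have hi1 := hm.integrable one_le_two
  have e : ∀ ξ : Seq p, (a + b * ξ k.1 k.2) ^ 2
      = a ^ 2 + (2 * a * b) * ξ k.1 k.2 + b ^ 2 * ξ k.1 k.2 ^ 2 := fun ξ => by ring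
  have hlin : Integrable (fun ξ : Seq p => a ^ 2 + (2 * a * b) * ξ k.1 k.2) (noiseLaw p) :=
    (integrable_const _).add (hi1.const_mul _)
  have hint : Integrable (fun ξ : Seq p => (a + b * ξ k.1 k.2) ^ 2) (noiseLaw p) := by
    simp only [e]
    exact hlin.add (hi.const_mul _)
  rw [← ofReal_integral_eq_lintegral_ofReal hint (Eventually.of_forall fun ξ => sq_nonneg _)]
  congr 1
  simp only [e]
  rw [integral_add hlin (hi.const_mul _),
    integral_add (integrable_const _) (hi1.const_mul _), integral_const_mul, integral_const_mul,
    integral_coord, integral_coord_sq]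
  simp

/-- The variance of the square of a standard Gaussian variable. -/
def sqVariance : ℝ := Var[fun x : ℝ => x ^ 2; gaussianReal 0 1]

/-- `∑ w k` is the mean of the quadratic form, so the left side is its variance, which adds up over
independent coordinates. It controls the prior mass outside the ellipsoid. -/
lemma lintegral_sq_sum_sub (F : Finset (ℕ × Fin p)) (w : ℕ × Fin p → ℝ) :
    ∫⁻ g, ENNReal.ofReal ((∑ k ∈ F, w k * g k.1 k.2 ^ 2 - ∑ k ∈ F, w k) ^ 2) ∂(noiseLaw p)
      = ENNReal.ofReal (sqVariance * ∑ k ∈ F, w k ^ 2) := by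
  have hsq : ∀ k : ℕ × Fin p, MemLp (fun g : Seq p => g k.1 k.2 ^ 2) 2 (noiseLaw p) := fun k => by
    have h4 : MemLp (fun g : Seq p => g k.1 k.2) 4 (noiseLaw p) :=
      (hasLaw_coord k).hasGaussianLaw.memLp (by norm_num)
    have : ENNReal.HolderTriple 4 4 2 := ⟨by
      rw [← two_mul, show (4 : ℝ≥0∞) = 2 * 2 by norm_num,
        ENNReal.mul_inv (Or.inl (by simp)) (Or.inl (by simp)), ← mul_assoc,
        ENNReal.mul_inv_cancel (by simp) (by simp), one_mul]⟩
    simp only [pow_two]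
    exact h4.mul h4
  have hmem : ∀ k ∈ F, MemLp (fun g : Seq p => w k * g k.1 k.2 ^ 2) 2 (noiseLaw p) :=
    fun k _ => (hsq k).const_mul _
  have hS : MemLp (∑ k ∈ F, fun g : Seq p => w k * g k.1 k.2 ^ 2) 2 (noiseLaw p) :=
    memLp_finsetSum' _ hmem
  have hES : ∫ g : Seq p, (∑ k ∈ F, fun g : Seq p => w k * g k.1 k.2 ^ 2) g ∂(noiseLaw p)
      = ∑ k ∈ F, w k := by
    simp only [Finset.sum_apply]
    rw [integral_finsetSum _ fun k hk => (hmem k hk).integrable one_le_two]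
    exact Finset.sum_congr rfl fun k _ => by rw [integral_const_mul, integral_coord_sq, mul_one]
  have hvar : Var[∑ k ∈ F, fun g : Seq p => w k * g k.1 k.2 ^ 2; noiseLaw p]
      = sqVariance * ∑ k ∈ F, w k ^ 2 := by
    rw [IndepFun.variance_sum hmem, Finset.mul_sum]
    · refine Finset.sum_congr rfl fun k _ => ?_
      rw [variance_const_mul, mul_comm]
      congr 1
      unfold sqVariance
      rw [← (hasLaw_coord k).map_eq, variance_map (by fun_prop) (measurable_coord k).aemeasurable]
      rfl
    · intro k _ l _ hkl
      exact (iIndepFun_coord.indepFun hkl).comp (φ := fun x : ℝ => w k * x ^ 2)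
        (ψ := fun x : ℝ => w l * x ^ 2) (by fun_prop) (by fun_prop)
  have hint : Integrable (fun g : Seq p =>
      ((∑ k ∈ F, fun g : Seq p => w k * g k.1 k.2 ^ 2) g - ∑ k ∈ F, w k) ^ 2) (noiseLaw p) :=
    (hS.sub (memLp_const _)).integrable_sq
  rw [← hvar, variance_eq_integral hS.aestronglyMeasurable.aemeasurable, hES,
    ofReal_integral_eq_lintegral_ofReal hint (Eventually.of_forall fun ξ => sq_nonneg _)]
  simp only [Finset.sum_apply]

end MPinsker

end

/-! ### From the Bayes risk of a Gaussian prior to the maximal risk on the ellipsoid. -/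

noncomputable section

namespace MPinsker

variable {p : ℕ} {β : ℝ} {q : Fin p → ℝ}

lemma tsum_ofReal_sum (f : ℕ → Fin p → ℝ) (hf : ∀ i j, 0 ≤ f i j) :
    ∑' i, ENNReal.ofReal (∑ j, f i j) = ∑' k : ℕ × Fin p, ENNReal.ofReal (f k.1 k.2) := by
  rw [ENNReal.tsum_prod (f := fun i j => ENNReal.ofReal (f i j))]
  refine tsum_congr fun i => ?_
  rw [tsum_fintype, ENNReal.ofReal_sum_of_nonneg fun j _ => hf i j]

lemma ofReal_sum_le_diagLoss (hq : ∀ j, 0 < q j) (F : Finset (ℕ × Fin p)) (θ t : Seq p) :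
    ENNReal.ofReal (∑ k ∈ F, q k.2 * (t k.1 k.2 - θ k.1 k.2) ^ 2) ≤ diagLoss q θ t := by
  have hnn : ∀ i j, 0 ≤ q j * (t i j - θ i j) ^ 2 := fun i j =>
    mul_nonneg (hq j).le (sq_nonneg _)
  unfold diagLoss
  rw [tsum_ofReal_sum (fun i j => q j * (t i j - θ i j) ^ 2) hnn,
    ENNReal.ofReal_sum_of_nonneg fun k _ => hnn k.1 k.2]
  exact ENNReal.sum_le_tsum F

/-- The weight of a squared coordinate in the definition of the ellipsoid. -/
def ellipsoidWeight (β : ℝ) (q : Fin p → ℝ) (k : ℕ × Fin p) : ℝ :=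
  sobolevCoeff β (k.1 + 1) ^ 2 * (q k.2)⁻¹

lemma ellipsoidWeight_nonneg (hq : ∀ j, 0 < q j) (k : ℕ × Fin p) : 0 ≤ ellipsoidWeight β q k :=
  mul_nonneg (sq_nonneg _) (inv_pos.2 (hq _)).le

lemma mem_diagEllipsoid_of_sum_le (hq : ∀ j, 0 < q j) {F : Finset (ℕ × Fin p)} {θ : Seq p}
    (hθ : ∀ k ∉ F, θ k.1 k.2 = 0)
    (h : ∑ k ∈ F, ellipsoidWeight β q k * θ k.1 k.2 ^ 2 ≤ 1) : θ ∈ diagEllipsoid β q := by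
  have hnn : ∀ k : ℕ × Fin p, 0 ≤ ellipsoidWeight β q k * θ k.1 k.2 ^ 2 := fun k =>
    mul_nonneg (ellipsoidWeight_nonneg hq k) (sq_nonneg _)
  have e : ∀ i, sobolevCoeff β (i + 1) ^ 2 * ∑ j, (q j)⁻¹ * θ i j ^ 2
      = ∑ j, ellipsoidWeight β q (i, j) * θ i j ^ 2 := fun i => by
    rw [Finset.mul_sum]
    exact Finset.sum_congr rfl fun j _ => by unfold ellipsoidWeight; ring
  unfold diagEllipsoid
  simp only [e, Set.mem_ofPred_eq]
  rw [tsum_ofReal_sum (fun i j => ellipsoidWeight β q (i, j) * θ i j ^ 2) fun i j => hnn (i, j),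
    tsum_eq_sum (s := F) fun k hk => by simp [hθ k hk],
    ← ENNReal.ofReal_sum_of_nonneg fun k _ => hnn k]
  exact ENNReal.ofReal_le_one.2 h

/-- Comparison of an estimate with its truncation at the ball `N ≤ 4 ρ`: on the ellipsoid the
truncation is at least as good, and outside the error is controlled by `(S - m)²`. -/
lemma truncation_loss_le (hq : ∀ j, 0 < q j) (F : Finset (ℕ × Fin p)) {ρ δ m : ℝ} (hρ0 : 0 ≤ ρ)
    (hρ : ∀ k ∈ F, q k.2 ≤ ρ * ellipsoidWeight β q k) (hδ : 0 < δ) (hm0 : 0 ≤ m) (hm : m ≤ 1 - δ)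
    (θ t t' : Seq p)
    (ht' : t' = if ∑ k ∈ F, q k.2 * t k.1 k.2 ^ 2 ≤ 4 * ρ then t else 0) :
    ∑ k ∈ F, q k.2 * (t' k.1 k.2 - θ k.1 k.2) ^ 2
      ≤ (if ∑ k ∈ F, ellipsoidWeight β q k * θ k.1 k.2 ^ 2 ≤ 1 then
          ∑ k ∈ F, q k.2 * (t k.1 k.2 - θ k.1 k.2) ^ 2 else 0)
        + 10 * ρ / δ ^ 2 * (∑ k ∈ F, ellipsoidWeight β q k * θ k.1 k.2 ^ 2 - m) ^ 2 := by
  set S := ∑ k ∈ F, ellipsoidWeight β q k * θ k.1 k.2 ^ 2 with hS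
  set N := ∑ k ∈ F, q k.2 * θ k.1 k.2 ^ 2 with hN
  have hNS : N ≤ ρ * S := by
    rw [hN, hS, Finset.mul_sum]
    refine Finset.sum_le_sum fun k hk => ?_
    nlinarith [hρ k hk, sq_nonneg (θ k.1 k.2)]
  have hC : 0 ≤ 10 * ρ / δ ^ 2 * (S - m) ^ 2 := by positivity
  have hloss : 0 ≤ ∑ k ∈ F, q k.2 * (t k.1 k.2 - θ k.1 k.2) ^ 2 :=
    Finset.sum_nonneg fun k _ => mul_nonneg (hq _).le (sq_nonneg _)
  have h0 : ∑ k ∈ F, q k.2 * ((0 : Seq p) k.1 k.2 - θ k.1 k.2) ^ 2 = N := by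
    refine Finset.sum_congr rfl fun k _ => ?_
    simp
  split_ifs with h1
  · by_cases h2 : ∑ k ∈ F, q k.2 * t k.1 k.2 ^ 2 ≤ 4 * ρ
    · rw [ht', if_pos h2]
      linarith
    · rw [ht', if_neg h2, h0]
      -- Inside the ellipsoid `N ≤ ρ`. An estimate of size above `4ρ` therefore has loss above `ρ`,
      -- while replacing it by zero costs only `N`.
      have h3 : ∑ k ∈ F, q k.2 * t k.1 k.2 ^ 2
          ≤ 2 * ∑ k ∈ F, q k.2 * (t k.1 k.2 - θ k.1 k.2) ^ 2 + 2 * N := by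
        rw [hN, Finset.mul_sum, Finset.mul_sum, ← Finset.sum_add_distrib]
        refine Finset.sum_le_sum fun k _ => ?_
        nlinarith [hq k.2, mul_nonneg (hq k.2).le (sq_nonneg (t k.1 k.2 - 2 * θ k.1 k.2))]
      have h4 : N ≤ ρ := by nlinarith
      linarith
  · rw [zero_add]
    push Not at h1
    have h5 : ∑ k ∈ F, q k.2 * t' k.1 k.2 ^ 2 ≤ 4 * ρ := by
      by_cases h2 : ∑ k ∈ F, q k.2 * t k.1 k.2 ^ 2 ≤ 4 * ρ
      · rwa [ht', if_pos h2]
      · rw [ht', if_neg h2]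
        simpa using hρ0
    have h6 : ∑ k ∈ F, q k.2 * (t' k.1 k.2 - θ k.1 k.2) ^ 2
        ≤ 2 * ∑ k ∈ F, q k.2 * t' k.1 k.2 ^ 2 + 2 * N := by
      rw [hN, Finset.mul_sum, Finset.mul_sum, ← Finset.sum_add_distrib]
      refine Finset.sum_le_sum fun k _ => ?_
      nlinarith [hq k.2, mul_nonneg (hq k.2).le (sq_nonneg (t' k.1 k.2 + θ k.1 k.2))]
    -- From `m ≤ 1 - δ` and `S > 1` follows `S - m ≥ δS`; this uses `δ ≤ 1`, which `0 ≤ m` provides.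
    -- Since the truncated loss is at most `8ρ + 2ρS ≤ 10ρS`, the constant `10` results.
    have h7 : S ≤ (S - m) ^ 2 / δ ^ 2 := by
      rw [le_div_iff₀ (by positivity)]
      have : δ * S ≤ S - m := by nlinarith
      have h8 : (δ * S) ^ 2 ≤ (S - m) ^ 2 := by
        gcongr
      nlinarith [sq_nonneg δ, mul_nonneg (sq_nonneg δ) (by nlinarith : 0 ≤ S ^ 2 - S)]
    calc _ ≤ 10 * ρ * S := by nlinarith
      _ ≤ 10 * ρ * ((S - m) ^ 2 / δ ^ 2) := by gcongr
      _ = _ := by ring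

/-- Lower bound for the maximal risk over the ellipsoid by the Bayes risk of a Gaussian prior whose
mass outside the ellipsoid is controlled by a variance. -/
theorem bayes_risk_le_of_diagRisk_le (hq : ∀ j, 0 < q j) {ε : ℝ} (hε : 0 < ε)
    {F : Finset (ℕ × Fin p)} {τ : Seq p} (hτ : ∀ k ∉ F, τ k.1 k.2 = 0) {ρ δ : ℝ} (hρ0 : 0 ≤ ρ)
    (hρ : ∀ k ∈ F, q k.2 ≤ ρ * ellipsoidWeight β q k) (hδ : 0 < δ)
    (hm : ∑ k ∈ F, ellipsoidWeight β q k * τ k.1 k.2 ^ 2 ≤ 1 - δ) {f : Seq p → Seq p}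
    (hf : Measurable f) {M : ℝ≥0∞} (hM : ∀ θ ∈ diagEllipsoid β q, diagRisk q ε θ f ≤ M) :
    ENNReal.ofReal (∑ k ∈ F, q k.2 * (ε ^ 2 * τ k.1 k.2 ^ 2 / (ε ^ 2 + τ k.1 k.2 ^ 2)))
      ≤ M + ENNReal.ofReal (10 * ρ / δ ^ 2 *
        (sqVariance * ∑ k ∈ F, (ellipsoidWeight β q k * τ k.1 k.2 ^ 2) ^ 2)) := by
  have hfk : ∀ k : ℕ × Fin p, Measurable fun y => f y k.1 k.2 := fun k =>
    (measurable_coord k).comp hf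
  let T : Seq p → Seq p := fun y =>
    if ∑ k ∈ F, q k.2 * f y k.1 k.2 ^ 2 ≤ 4 * ρ then f y else 0
  have hT : Measurable T := by
    refine Measurable.ite (measurableSet_le ?_ measurable_const) hf measurable_const
    exact Finset.measurable_sum _ fun k _ => ((hfk k).pow_const 2).const_mul _
  have hTk : ∀ k : ℕ × Fin p, Measurable fun y => T y k.1 k.2 := fun k =>
    (measurable_coord k).comp hT
  have hobs : Measurable (observe (p := p) τ ε) :=
    measurable_pi_iff.2 fun i => measurable_pi_iff.2 fun j => measurable_comb _ _ (i, j)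
  have hterm : ∀ k : ℕ × Fin p, Measurable fun ω : Seq p × Seq p =>
      q k.2 * (T (observe τ ε ω) k.1 k.2 - τ k.1 k.2 * ω.1 k.1 k.2) ^ 2 := fun k =>
    ((((hTk k).comp hobs).sub (((measurable_coord k).comp measurable_fst).const_mul _)).pow_const
      2).const_mul _
  have hnn : ∀ (k : ℕ × Fin p) (ω : Seq p × Seq p),
      0 ≤ q k.2 * (T (observe τ ε ω) k.1 k.2 - τ k.1 k.2 * ω.1 k.1 k.2) ^ 2 := fun k ω =>
    mul_nonneg (hq _).le (sq_nonneg _)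
  let m := ∑ k ∈ F, ellipsoidWeight β q k * τ k.1 k.2 ^ 2
  have hm0 : 0 ≤ m := Finset.sum_nonneg fun k _ =>
    mul_nonneg (ellipsoidWeight_nonneg hq k) (sq_nonneg _)
  let S : Seq p → ℝ := fun g => ∑ k ∈ F, ellipsoidWeight β q k * (τ k.1 k.2 * g k.1 k.2) ^ 2
  have hSm : Measurable S := Finset.measurable_sum _ fun k _ =>
    (((measurable_coord k).const_mul _).pow_const 2).const_mul _
  let C := 10 * ρ / δ ^ 2
  have hC : 0 ≤ C := by positivity
  calc ENNReal.ofReal (∑ k ∈ F, q k.2 * (ε ^ 2 * τ k.1 k.2 ^ 2 / (ε ^ 2 + τ k.1 k.2 ^ 2)))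
      = ∑ k ∈ F, ENNReal.ofReal (q k.2) *
          ENNReal.ofReal (ε ^ 2 * τ k.1 k.2 ^ 2 / (ε ^ 2 + τ k.1 k.2 ^ 2)) := by
        rw [ENNReal.ofReal_sum_of_nonneg fun k _ => mul_nonneg (hq _).le (by positivity)]
        exact Finset.sum_congr rfl fun k _ => ENNReal.ofReal_mul (hq _).le
    _ ≤ ∑ k ∈ F, ∫⁻ ω, ENNReal.ofReal (q k.2 *
          (T (observe τ ε ω) k.1 k.2 - τ k.1 k.2 * ω.1 k.1 k.2) ^ 2)
            ∂((noiseLaw p).prod (noiseLaw p)) := by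
        refine Finset.sum_le_sum fun k _ => ?_
        simp only [ENNReal.ofReal_mul (hq k.2).le]
        rw [lintegral_const_mul' _ _ ENNReal.ofReal_ne_top]
        gcongr
        exact bayes_risk_coord τ hε k (hTk k)
    _ = ∫⁻ ω, ENNReal.ofReal (∑ k ∈ F, q k.2 *
          (T (observe τ ε ω) k.1 k.2 - τ k.1 k.2 * ω.1 k.1 k.2) ^ 2)
            ∂((noiseLaw p).prod (noiseLaw p)) := by
        rw [← lintegral_finsetSum _ fun k _ => (hterm k).ennreal_ofReal]
        exact lintegral_congr fun ω => (ENNReal.ofReal_sum_of_nonneg fun k _ => hnn k ω).symm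
    _ = ∫⁻ g, ∫⁻ ξ, ENNReal.ofReal (∑ k ∈ F, q k.2 *
          (T (observe τ ε (g, ξ)) k.1 k.2 - τ k.1 k.2 * g k.1 k.2) ^ 2)
            ∂(noiseLaw p) ∂(noiseLaw p) := by
        rw [lintegral_prod _ (Finset.measurable_sum _ fun k _ =>
          hterm k).ennreal_ofReal.aemeasurable]
    -- Condition on the signal. If `S g ≤ 1` it lies in the ellipsoid and the risk of `f` is at most
    -- `M`; otherwise only the variance term remains.
    _ ≤ ∫⁻ g, (M + ENNReal.ofReal (C * (S g - m) ^ 2)) ∂(noiseLaw p) := by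
        refine lintegral_mono fun g => ?_
        let θ : Seq p := fun i j => τ i j * g i j
        have hpt : ∀ ξ : Seq p, ENNReal.ofReal (∑ k ∈ F, q k.2 *
            (T (observe τ ε (g, ξ)) k.1 k.2 - τ k.1 k.2 * g k.1 k.2) ^ 2)
            ≤ (if S g ≤ 1 then diagLoss q θ (f (fun i j => θ i j + ε * ξ i j)) else 0)
              + ENNReal.ofReal (C * (S g - m) ^ 2) := fun ξ => by
          refine (ENNReal.ofReal_le_ofReal (truncation_loss_le hq F hρ0 hρ hδ hm0 hm θ
            (f (observe τ ε (g, ξ))) (T (observe τ ε (g, ξ))) rfl)).trans ?_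
          refine ENNReal.ofReal_add_le.trans ?_
          gcongr
          change ENNReal.ofReal (if S g ≤ 1 then _ else 0) ≤ _
          split_ifs with h
          · exact ofReal_sum_le_diagLoss hq F _ _
          · simp
        refine (lintegral_mono hpt).trans ?_
        rw [lintegral_add_right _ measurable_const, lintegral_const, measure_univ, mul_one]
        gcongr
        split_ifs with h
        · refine hM θ (mem_diagEllipsoid_of_sum_le hq (F := F) (fun k hk => ?_) h)
          simp [θ, hτ k hk]
        · simp
    _ = M + ENNReal.ofReal (C * (sqVariance *
          ∑ k ∈ F, (ellipsoidWeight β q k * τ k.1 k.2 ^ 2) ^ 2)) := by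
        rw [lintegral_add_left measurable_const, lintegral_const, measure_univ, mul_one]
        congr 1
        simp only [ENNReal.ofReal_mul hC]
        rw [lintegral_const_mul' _ _ ENNReal.ofReal_ne_top,
          ← lintegral_sq_sum_sub F fun k => ellipsoidWeight β q k * τ k.1 k.2 ^ 2]
        congr 1
        refine lintegral_congr fun g => ?_
        congr 3
        exact Finset.sum_congr rfl fun k _ => by ring

end MPinsker

end

/-! ### Nonasymptotic upper and lower bounds. -/

noncomputable section

namespace MPinsker

variable {p : ℕ} {β : ℝ} {q : Fin p → ℝ}

/-- The value `ε² ∑ᵢ ∑ⱼ qⱼ (1 - a_{β,i+1} κ / qⱼ)₊` of the linear minimax problem. -/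
def pinskerBound (β : ℝ) (q : Fin p → ℝ) (ε κ : ℝ) : ℝ :=
  ε ^ 2 * ∑' i, ∑ j, q j * pinskerWeight β (q j) κ i

lemma one_sub_pinskerWeight_le (β r κ : ℝ) (i : ℕ) :
    1 - pinskerWeight β r κ i ≤ sobolevCoeff β (i + 1) * κ * r⁻¹ := by
  have := le_max_right 0 (1 - sobolevCoeff β (i + 1) * κ * r⁻¹)
  unfold pinskerWeight
  linarith

/-- Complementary slackness: either the weight vanishes or it equals `1 - aκ/r`. -/
lemma pinskerWeight_mul_eq (β r κ : ℝ) (i : ℕ) :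
    pinskerWeight β r κ i * (sobolevCoeff β (i + 1) * κ * r⁻¹)
      = pinskerWeight β r κ i * (1 - pinskerWeight β r κ i) := by
  unfold pinskerWeight
  rcases le_total 0 (1 - sobolevCoeff β (i + 1) * κ * r⁻¹) with h | h
  · rw [max_eq_right h]; ring
  · rw [max_eq_left h]; ring

lemma summable_sum_mul_pinskerWeight (hβ : 0 < β) (hq : ∀ j, 0 < q j) {κ : ℝ} (hκ : 0 < κ)
    (f : ℕ → Fin p → ℝ) : Summable fun i => ∑ j, f i j * pinskerWeight β (q j) κ i :=
  summable_sum fun j _ => summable_mul_pinskerWeight hβ (hq j) hκ fun i => f i j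

lemma tsum_coeff_mul_sum_eq {ε κ : ℝ} (hκ : 0 < κ) (hroot : ε ^ 2 * pinskerSum β q κ⁻¹ = 1) :
    ε ^ 2 * ∑' i, ∑ j, sobolevCoeff β (i + 1) * pinskerWeight β (q j) κ i = κ := by
  rw [← inv_mul_tsum_eq_pinskerSum hκ] at hroot
  simp only [← Finset.mul_sum]
  field_simp at hroot
  exact hroot

/-- Bias–variance decomposition, coordinate by coordinate. -/
lemma diagRisk_linear_eq (hq : ∀ j, 0 < q j) (ε : ℝ) (θ : Seq p) (w : ℕ → Fin p → ℝ) :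
    diagRisk q ε θ (fun y i j => w i j * y i j)
      = ∑' i, ENNReal.ofReal (∑ j, q j * ((1 - w i j) ^ 2 * θ i j ^ 2 + ε ^ 2 * w i j ^ 2)) := by
  have hmeas : ∀ i j, Measurable fun ξ : Seq p =>
      ENNReal.ofReal (q j * (w i j * (θ i j + ε * ξ i j) - θ i j) ^ 2) := fun i j => by
    have := measurable_coord (p := p) (i, j)
    fun_prop
  have hnn : ∀ (ξ : Seq p) i j, 0 ≤ q j * (w i j * (θ i j + ε * ξ i j) - θ i j) ^ 2 :=
    fun ξ i j => mul_nonneg (hq j).le (sq_nonneg _)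
  unfold diagRisk diagLoss
  simp only [ENNReal.ofReal_sum_of_nonneg fun j _ => hnn _ _ j]
  rw [lintegral_tsum fun i => (Finset.measurable_sum _ fun j _ => hmeas i j).aemeasurable]
  refine tsum_congr fun i => ?_
  rw [lintegral_finsetSum _ fun j _ => hmeas i j,
    ENNReal.ofReal_sum_of_nonneg fun j _ => mul_nonneg (hq j).le (by positivity)]
  refine Finset.sum_congr rfl fun j _ => ?_
  simp only [ENNReal.ofReal_mul (hq j).le]
  rw [lintegral_const_mul' _ _ ENNReal.ofReal_ne_top]
  congr 1
  have e : ∀ ξ : Seq p, w i j * (θ i j + ε * ξ i j) - θ i j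
      = -((1 - w i j) * θ i j) + (ε * w i j) * ξ i j := fun ξ => by ring
  simp only [e]
  rw [lintegral_sq_affine_coord _ _ (i, j)]
  congr 1
  ring

/-- The maximal risk of the Pinsker estimator is at most `pinskerBound`. -/
theorem diagRisk_pinsker_le (hβ : 0 < β) (hq : ∀ j, 0 < q j) {ε κ : ℝ} (hκ : 0 < κ)
    (hroot : ε ^ 2 * pinskerSum β q κ⁻¹ = 1) {θ : Seq p} (hθ : θ ∈ diagEllipsoid β q) :
    diagRisk q ε θ (fun y i j => pinskerWeight β (q j) κ i * y i j)
      ≤ ENNReal.ofReal (pinskerBound β q ε κ) := by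
  set w : ℕ → Fin p → ℝ := fun i j => pinskerWeight β (q j) κ i with hw
  rw [diagRisk_linear_eq hq]
  have hterm : ∀ i, ENNReal.ofReal (∑ j, q j * ((1 - w i j) ^ 2 * θ i j ^ 2 + ε ^ 2 * w i j ^ 2))
      ≤ ENNReal.ofReal (κ ^ 2) *
          ENNReal.ofReal (sobolevCoeff β (i + 1) ^ 2 * ∑ j, (q j)⁻¹ * θ i j ^ 2)
        + ENNReal.ofReal (ε ^ 2 * ∑ j, q j * w i j ^ 2) := fun i => by
    rw [← ENNReal.ofReal_mul (sq_nonneg κ)]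
    refine le_trans (ENNReal.ofReal_le_ofReal ?_) ENNReal.ofReal_add_le
    simp only [Finset.mul_sum]
    rw [← Finset.sum_add_distrib]
    refine Finset.sum_le_sum fun j _ => ?_
    have h0 : 0 ≤ 1 - w i j := by linarith [pinskerWeight_le_one (β := β) (hq j) hκ.le i]
    have h1 : (1 - w i j) ^ 2 ≤ (sobolevCoeff β (i + 1) * κ * (q j)⁻¹) ^ 2 :=
      pow_le_pow_left₀ h0 (one_sub_pinskerWeight_le β (q j) κ i) 2
    have h2 := mul_le_mul_of_nonneg_left h1
      (mul_nonneg (hq j).le (sq_nonneg (θ i j)))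
    have h3 : q j * θ i j ^ 2 * (sobolevCoeff β (i + 1) * κ * (q j)⁻¹) ^ 2
        = κ ^ 2 * (sobolevCoeff β (i + 1) ^ 2 * ((q j)⁻¹ * θ i j ^ 2)) := by
      have := (hq j).ne'
      field_simp
    nlinarith
  have hs1 := summable_sum_mul_pinskerWeight hβ hq hκ fun i j => q j * w i j
  have hs2 := summable_sum_mul_pinskerWeight hβ hq hκ fun i _ => sobolevCoeff β (i + 1)
  have e1 : ∀ i, ∑ j, q j * w i j ^ 2 = ∑ j, q j * w i j * pinskerWeight β (q j) κ i := fun i =>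
    Finset.sum_congr rfl fun j _ => by rw [hw]; ring
  -- The root equation gives `κ² = ε² ∑ κ a w`, which is `ε² ∑ q w (1 - w)` by slackness. Adding the
  -- variance leaves `ε² ∑ q w`.
  have hsum : κ ^ 2 + ε ^ 2 * ∑' i, ∑ j, q j * w i j ^ 2 = pinskerBound β q ε κ := by
    have hk : κ ^ 2 = ε ^ 2 *
        ∑' i, κ * ∑ j, sobolevCoeff β (i + 1) * pinskerWeight β (q j) κ i := by
      rw [tsum_mul_left]
      linear_combination (-κ) * tsum_coeff_mul_sum_eq hκ hroot
    unfold pinskerBound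
    rw [hk, ← mul_add]
    simp only [e1]
    rw [← (hs2.mul_left κ).tsum_add hs1]
    congr 1
    refine tsum_congr fun i => ?_
    rw [Finset.mul_sum, ← Finset.sum_add_distrib]
    refine Finset.sum_congr rfl fun j _ => ?_
    have h := pinskerWeight_mul_eq β (q j) κ i
    have hqj := (hq j).ne'
    have h' : pinskerWeight β (q j) κ i * (sobolevCoeff β (i + 1) * κ)
        = q j * (pinskerWeight β (q j) κ i * (1 - pinskerWeight β (q j) κ i)) := by
      rw [← h]; field_simp
    rw [hw]
    linear_combination h'
  calc _ ≤ ∑' i, (ENNReal.ofReal (κ ^ 2) *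
          ENNReal.ofReal (sobolevCoeff β (i + 1) ^ 2 * ∑ j, (q j)⁻¹ * θ i j ^ 2)
        + ENNReal.ofReal (ε ^ 2 * ∑ j, q j * w i j ^ 2)) := ENNReal.tsum_le_tsum hterm
    _ = ENNReal.ofReal (κ ^ 2) *
          ∑' i, ENNReal.ofReal (sobolevCoeff β (i + 1) ^ 2 * ∑ j, (q j)⁻¹ * θ i j ^ 2)
        + ENNReal.ofReal (∑' i, ε ^ 2 * ∑ j, q j * w i j ^ 2) := by
        rw [ENNReal.tsum_add, ENNReal.tsum_mul_left, ENNReal.ofReal_tsum_of_nonneg]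
        · exact fun i => mul_nonneg (sq_nonneg _) (Finset.sum_nonneg fun j _ =>
            mul_nonneg (hq j).le (sq_nonneg _))
        · simp only [e1]
          exact hs1.mul_left _
    _ ≤ ENNReal.ofReal (κ ^ 2) * 1 + ENNReal.ofReal (∑' i, ε ^ 2 * ∑ j, q j * w i j ^ 2) := by
        gcongr
        exact hθ
    _ = ENNReal.ofReal (pinskerBound β q ε κ) := by
        rw [mul_one, ← ENNReal.ofReal_add (sq_nonneg κ), tsum_mul_left, hsum]
        exact tsum_nonneg fun i => mul_nonneg (sq_nonneg _) (Finset.sum_nonneg fun j _ =>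
            mul_nonneg (hq j).le (sq_nonneg _))

/-- Nonasymptotic lower bound: `n` is the number of low frequencies that are dropped, and `1 - δ`
the factor by which the least favourable prior is shrunk. -/
theorem lower_bound_of_diagRisk_le (hβ : 0 < β) (hq : ∀ j, 0 < q j) {ε κ : ℝ} (hε : 0 < ε)
    (hκ : 0 < κ) (hroot : ε ^ 2 * pinskerSum β q κ⁻¹ = 1) {b : ℝ} (hb : ∀ j, q j ≤ b)
    (hb0 : 0 < b) {δ : ℝ} (hδ : 0 < δ) (hδ1 : δ < 1) {n : ℕ} (hn : 0 < n) {f : Seq p → Seq p}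
    (hf : Measurable f) {M : ℝ≥0∞} (hM : ∀ θ ∈ diagEllipsoid β q, diagRisk q ε θ f ≤ M) :
    ENNReal.ofReal ((1 - δ) * (pinskerBound β q ε κ - ε ^ 2 * (n * ∑ j, q j))
      - 10 * (b / (n : ℝ) ^ β) ^ 2 / δ ^ 2 * (sqVariance * (ε ^ 2 * b / κ ^ 2))) ≤ M := by
  obtain ⟨N, hN⟩ : ∃ N, ∀ i, N ≤ i → ∀ j, pinskerWeight β (q j) κ i = 0 :=
    eventually_atTop.1 (eventually_all.2 fun j => eventually_pinskerWeight_eq_zero hβ (hq j) hκ)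
  let w : ℕ × Fin p → ℝ := fun k => pinskerWeight β (q k.2) κ k.1
  let a : ℕ × Fin p → ℝ := fun k => sobolevCoeff β (k.1 + 1)
  have hw0 : ∀ k, 0 ≤ w k := fun k => pinskerWeight_nonneg _ _ _ _
  have hw1 : ∀ k, w k ≤ 1 := fun k => pinskerWeight_le_one (hq _) hκ.le _
  have ha0 : ∀ k, 0 ≤ a k := fun k => sobolevCoeff_nonneg _ _
  have hwa : ∀ k, w k * (a k * κ * (q k.2)⁻¹) = w k * (1 - w k) := fun k =>
    pinskerWeight_mul_eq _ _ _ _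
  -- Starting at `n ≥ 1` excludes the zero coefficient at index `0`, by which the prior variance
  -- would be divided, and gives `a ≥ n ^ β`.
  let F : Finset (ℕ × Fin p) := Finset.Ico n N ×ˢ Finset.univ
  have hFn : ∀ k ∈ F, n ≤ k.1 := fun k hk => by
    simp only [F, Finset.mem_product, Finset.mem_Ico] at hk
    exact hk.1.1
  have hnβ : 0 < (n : ℝ) ^ β := Real.rpow_pos_of_pos (by exact_mod_cast hn) β
  have han : ∀ k ∈ F, (n : ℝ) ^ β ≤ a k := fun k hk =>
    (Real.rpow_le_rpow (by positivity) (by exact_mod_cast hFn k hk) hβ.le).trans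
      (rpow_le_sobolevCoeff hβ k.1)
  -- Without `1 - δ` this variance solves `v / (ε² + v) = w`, so the Pinsker weight is the Bayes
  -- weight. The factor leaves a margin `δ` in the ellipsoid constraint.
  let v : ℕ × Fin p → ℝ := fun k => (1 - δ) * ε ^ 2 * (q k.2 * w k / (κ * a k))
  have hv0 : ∀ k, 0 ≤ v k := fun k => by
    have := (hq k.2).le
    have := hw0 k
    have := ha0 k
    have : 0 ≤ 1 - δ := by linarith
    positivity
  let τ : Seq p := fun i j => if (i, j) ∈ F then √(v (i, j)) else 0
  have hτF : ∀ k ∈ F, τ k.1 k.2 ^ 2 = v k := fun k hk => by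
    simp only [τ, Prod.mk.eta, hk, if_true]
    exact Real.sq_sqrt (hv0 k)
  have hτ : ∀ k ∉ F, τ k.1 k.2 = 0 := fun k hk => by
    simp [τ, hk]
  have hx : ∀ k ∈ F, ellipsoidWeight β q k * τ k.1 k.2 ^ 2
      = (1 - δ) * (ε ^ 2 * κ⁻¹) * (a k * w k) := fun k hk => by
    have h1 : a k ≠ 0 := (hnβ.trans_le (han k hk)).ne'
    have h2 := (hq k.2).ne'
    rw [hτF k hk]
    change a k ^ 2 * (q k.2)⁻¹ * ((1 - δ) * ε ^ 2 * (q k.2 * w k / (κ * a k))) = _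
    field_simp
  have hsumF : ∑ k ∈ F, a k * w k
      ≤ ∑' i, ∑ j, sobolevCoeff β (i + 1) * pinskerWeight β (q j) κ i := by
    rw [Finset.sum_product]
    exact (summable_sum_mul_pinskerWeight hβ hq hκ fun i _ => sobolevCoeff β (i + 1)).sum_le_tsum _
      fun i _ => Finset.sum_nonneg fun j _ => mul_nonneg (ha0 (i, j)) (hw0 (i, j))
  have hmass : ε ^ 2 * κ⁻¹ * ∑ k ∈ F, a k * w k ≤ 1 := by
    have h := tsum_coeff_mul_sum_eq hκ hroot
    calc _ ≤ ε ^ 2 * κ⁻¹ * ∑' i, ∑ j, sobolevCoeff β (i + 1) * pinskerWeight β (q j) κ i := by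
          gcongr
      _ = κ⁻¹ * (ε ^ 2 * ∑' i, ∑ j, sobolevCoeff β (i + 1) * pinskerWeight β (q j) κ i) := by
          ring
      _ = 1 := by rw [h, inv_mul_cancel₀ hκ.ne']
  have hm : ∑ k ∈ F, ellipsoidWeight β q k * τ k.1 k.2 ^ 2 ≤ 1 - δ := by
    rw [Finset.sum_congr rfl hx, ← Finset.mul_sum]
    nlinarith
  have hρ : ∀ k ∈ F, q k.2 ≤ (b / (n : ℝ) ^ β) ^ 2 * ellipsoidWeight β q k := fun k hk => by
    have h1 : 1 ≤ a k / (n : ℝ) ^ β := (one_le_div hnβ).2 (han k hk)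
    have h2 : q k.2 ≤ b * (a k / (n : ℝ) ^ β) := by nlinarith [hb k.2, hq k.2]
    have h3 : q k.2 ^ 2 ≤ (b * (a k / (n : ℝ) ^ β)) ^ 2 := pow_le_pow_left₀ (hq _).le h2 2
    change q k.2 ≤ (b / (n : ℝ) ^ β) ^ 2 * (a k ^ 2 * (q k.2)⁻¹)
    have h4 : (b / (n : ℝ) ^ β) ^ 2 * (a k ^ 2 * (q k.2)⁻¹)
        = (b * (a k / (n : ℝ) ^ β)) ^ 2 / q k.2 := by
      field_simp
    rw [h4, le_div_iff₀ (hq _)]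
    nlinarith
  have hsq : ∑ k ∈ F, (ellipsoidWeight β q k * τ k.1 k.2 ^ 2) ^ 2 ≤ ε ^ 2 * b / κ ^ 2 := by
    have hx1 : ∀ k ∈ F, (ellipsoidWeight β q k * τ k.1 k.2 ^ 2) ^ 2
        ≤ ε ^ 2 * b / κ ^ 2 * (ε ^ 2 * κ⁻¹ * (a k * w k)) := fun k hk => by
      rw [hx k hk]
      have h0 : 0 ≤ a k * w k := mul_nonneg (ha0 k) (hw0 k)
      -- By slackness `w a κ = q w (1 - w) ≤ q`. Each ellipsoid contribution is thus at most `ε² b /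
      -- κ²`, and the contributions sum to at most `1`, which bounds their squares.
      have h1 : a k * w k * κ ≤ b := by
        have h2 := hwa k
        have h3 : w k * (a k * κ) = q k.2 * (w k * (1 - w k)) := by
          rw [← h2]; have := (hq k.2).ne'; field_simp
        have h4 : w k * (1 - w k) ≤ 1 := by nlinarith [hw0 k, hw1 k]
        nlinarith [hb k.2, hq k.2]
      have h5 : ε ^ 2 * κ⁻¹ * (a k * w k) ≤ ε ^ 2 * b / κ ^ 2 := by
        rw [le_div_iff₀ (by positivity)]
        have : ε ^ 2 * κ⁻¹ * (a k * w k) * κ ^ 2 = ε ^ 2 * (a k * w k * κ) := by field_simp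
        rw [this]
        gcongr
      have h6 : 0 ≤ ε ^ 2 * κ⁻¹ * (a k * w k) := by positivity
      have h7 : (1 - δ) * (ε ^ 2 * κ⁻¹) * (a k * w k) = (1 - δ) * (ε ^ 2 * κ⁻¹ * (a k * w k)) := by
        ring
      rw [h7, mul_pow]
      have h8 : (1 - δ) ^ 2 ≤ 1 := by nlinarith
      calc _ ≤ 1 * (ε ^ 2 * κ⁻¹ * (a k * w k)) ^ 2 := by gcongr
        _ ≤ _ := by nlinarith
    calc _ ≤ ∑ k ∈ F, ε ^ 2 * b / κ ^ 2 * (ε ^ 2 * κ⁻¹ * (a k * w k)) := Finset.sum_le_sum hx1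
      _ = ε ^ 2 * b / κ ^ 2 * (ε ^ 2 * κ⁻¹ * ∑ k ∈ F, a k * w k) := by
          simp only [Finset.mul_sum]
      _ ≤ ε ^ 2 * b / κ ^ 2 * 1 := by gcongr
      _ = _ := mul_one _
  have hbayes : ∀ k ∈ F, (1 - δ) * (ε ^ 2 * (q k.2 * w k))
      ≤ q k.2 * (ε ^ 2 * τ k.1 k.2 ^ 2 / (ε ^ 2 + τ k.1 k.2 ^ 2)) := fun k hk => by
    rw [hτF k hk]
    have h1 : 0 < a k := hnβ.trans_le (han k hk)
    have h2 := hq k.2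
    have hz : 0 < a k * κ * (q k.2)⁻¹ := by positivity
    set z := a k * κ * (q k.2)⁻¹ with hzdef
    have hvz : v k = (1 - δ) * ε ^ 2 * (w k / z) := by
      simp only [v, hzdef]
      field_simp
    -- Equality would hold for `δ = 0`. Shrinking the prior costs at most the factor `1 - δ` in
    -- Bayes risk.
    have hkey : w k * (ε ^ 2 + v k) ≤ ε ^ 2 * (w k / z) := by
      have h3 : w k * z = w k * (1 - w k) := hwa k
      have h4 : w k + w k * (w k / z) = w k / z := by
        field_simp
        linear_combination h3
      have h5 : 0 ≤ w k * (w k / z) := mul_nonneg (hw0 k) (div_nonneg (hw0 k) hz.le)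
      have h6 : ε ^ 2 * (w k / z) = ε ^ 2 * (w k + w k * (w k / z)) := by rw [h4]
      rw [hvz, h6]
      nlinarith [mul_nonneg hδ.le (mul_nonneg (sq_nonneg ε) h5)]
    have hd : 0 < ε ^ 2 + v k := by have := hv0 k; positivity
    have h6 : (1 - δ) * w k ≤ v k / (ε ^ 2 + v k) := by
      rw [le_div_iff₀ hd, hvz]
      rw [hvz] at hkey
      have : 0 ≤ 1 - δ := by linarith
      nlinarith [mul_le_mul_of_nonneg_left hkey this]
    calc (1 - δ) * (ε ^ 2 * (q k.2 * w k)) = q k.2 * (ε ^ 2 * ((1 - δ) * w k)) := by ring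
      _ ≤ q k.2 * (ε ^ 2 * (v k / (ε ^ 2 + v k))) := by gcongr
      _ = _ := by ring
  have hmain := bayes_risk_le_of_diagRisk_le hq hε hτ (sq_nonneg _) hρ hδ hm hf hM
  have hV : 0 ≤ sqVariance := variance_nonneg _ _
  have hdrop : pinskerBound β q ε κ - ε ^ 2 * (n * ∑ j, q j) ≤ ε ^ 2 * ∑ k ∈ F, q k.2 * w k := by
    have h1 : ∑' i, ∑ j, q j * pinskerWeight β (q j) κ i
        ≤ n * ∑ j, q j + ∑ k ∈ F, q k.2 * w k := by
      rw [tsum_eq_sum (s := Finset.range (max n N)) fun i hi => Finset.sum_eq_zero fun j _ => by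
        rw [hN i (by simp at hi; omega) j, mul_zero]]
      have hsub : Finset.range (max n N) ⊆ Finset.range n ∪ Finset.Ico n N := fun i hi => by
        simp at hi ⊢; omega
      have hnn : ∀ i, 0 ≤ ∑ j, q j * pinskerWeight β (q j) κ i := fun i =>
        Finset.sum_nonneg fun j _ => mul_nonneg (hq j).le (hw0 (i, j))
      refine (Finset.sum_le_sum_of_subset_of_nonneg hsub fun i _ _ => hnn i).trans ?_
      rw [Finset.sum_union (Finset.disjoint_left.2 fun i hi hi' => by simp at hi hi'; omega),
        Finset.sum_product]
      gcongr
      calc _ ≤ ∑ _i ∈ Finset.range n, ∑ j, q j := by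
            refine Finset.sum_le_sum fun i _ => Finset.sum_le_sum fun j _ => ?_
            nlinarith [hq j, hw1 (i, j)]
        _ = _ := by simp
    unfold pinskerBound
    nlinarith [sq_nonneg ε]
  rw [ENNReal.ofReal_sub _ (by positivity), tsub_le_iff_right]
  refine (ENNReal.ofReal_le_ofReal ?_).trans (hmain.trans ?_)
  · calc _ ≤ (1 - δ) * (ε ^ 2 * ∑ k ∈ F, q k.2 * w k) := by
          have : 0 ≤ 1 - δ := by linarith
          gcongr
      _ = ∑ k ∈ F, (1 - δ) * (ε ^ 2 * (q k.2 * w k)) := by simp only [Finset.mul_sum]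
      _ ≤ _ := Finset.sum_le_sum hbayes
  · gcongr

end MPinsker

end

/-! ### Asymptotics of the bounds as the noise level tends to zero. -/

noncomputable section

namespace MPinsker

variable {p : ℕ} {β : ℝ} {q : Fin p → ℝ}

theorem tendsto_rpow_mul_tsum_sum_pinskerWeight (hβ : 0 < β) (hq : ∀ j, 0 < q j) :
    Tendsto (fun κ : ℝ => κ ^ (1 / β) * ∑' i, ∑ j, q j * pinskerWeight β (q j) κ i) (𝓝[>] 0)
      (𝓝 (β * (∑ j, q j ^ ((β + 1) / β)) / (β + 1))) := by
  have h := tendsto_finsetSum Finset.univ fun j _ =>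
    tendsto_rpow_mul_tsum_pinskerWeight hβ (hq j)
  rw [← Finset.sum_mul] at h
  have e : (∑ j, q j ^ ((β + 1) / β)) * (β / (β + 1))
      = β * (∑ j, q j ^ ((β + 1) / β)) / (β + 1) := by
    ring
  rw [e] at h
  refine h.congr' ?_
  filter_upwards [self_mem_nhdsWithin] with κ hκ
  rw [← Finset.mul_sum, Summable.tsum_finsetSum fun j _ =>
    summable_mul_pinskerWeight hβ (hq j) hκ fun _ => q j]

theorem tendsto_rpow_mul_tsum_coeff (hβ : 0 < β) (hq : ∀ j, 0 < q j) :
    Tendsto (fun κ : ℝ => κ ^ (1 + 1 / β) *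
        ∑' i, ∑ j, sobolevCoeff β (i + 1) * pinskerWeight β (q j) κ i) (𝓝[>] 0)
      (𝓝 (β * (∑ j, q j ^ ((β + 1) / β)) / (β + 1) / (2 * β + 1))) := by
  have h := tendsto_finsetSum Finset.univ fun j _ =>
    tendsto_rpow_mul_tsum_sobolevCoeff_mul hβ (hq j)
  rw [← Finset.sum_mul] at h
  have e : (∑ j, q j ^ ((β + 1) / β)) * (β / ((β + 1) * (2 * β + 1)))
      = β * (∑ j, q j ^ ((β + 1) / β)) / (β + 1) / (2 * β + 1) := by
    field_simp
  rw [e] at h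
  refine h.congr' ?_
  filter_upwards [self_mem_nhdsWithin] with κ hκ
  rw [← Finset.mul_sum, Summable.tsum_finsetSum fun j _ =>
    summable_mul_pinskerWeight hβ (hq j) hκ fun i => sobolevCoeff β (i + 1)]

/-- The constant in the Pinsker bound in terms of `B = β tr(Q^{(β+1)/β}) / (β+1)`. -/
lemma pinsker_constant_mul_rpow {B : ℝ} (hβ : 0 < β) (hB : 0 < B) :
    (2 * β + 1) ^ (1 / (2 * β + 1)) * B ^ (2 * β / (2 * β + 1))
      * (B / (2 * β + 1)) ^ (1 / (2 * β + 1)) = B := by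
  have h1 : 0 < 2 * β + 1 := by positivity
  rw [Real.div_rpow hB.le h1.le]
  have h2 : (2 * β + 1) ^ (1 / (2 * β + 1)) ≠ 0 := by positivity
  have h3 : B ^ (2 * β / (2 * β + 1)) * B ^ (1 / (2 * β + 1)) = B := by
    rw [← Real.rpow_add hB, ← add_div, div_self h1.ne', Real.rpow_one]
  field_simp
  exact h3

/-- The rate `ε ^ (4β/(2β+1))` in terms of `ε² κ^{-1/β}` for the root `κ`. -/
theorem tendsto_rate_div (hβ : 0 < β) (hq : ∀ j, 0 < q j) (hp : 0 < p) {κ : ℝ → ℝ}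
    (hκ : ∀ ε, 0 < ε → 0 < κ ε ∧ ε ^ 2 * pinskerSum β q (κ ε)⁻¹ = 1) {B : ℝ}
    (hB : B = β * (∑ j, q j ^ ((β + 1) / β)) / (β + 1)) :
    Tendsto (fun ε => (2 * β + 1) ^ (1 / (2 * β + 1)) * B ^ (2 * β / (2 * β + 1))
      * ε ^ (4 * β / (2 * β + 1)) / (ε ^ 2 * κ ε ^ (-(1 / β)))) (𝓝[>] 0) (𝓝 B) := by
  have h1 : 0 < 2 * β + 1 := by positivity
  have hBpos : 0 < B := by
    rw [hB]
    have : 0 < ∑ j, q j ^ ((β + 1) / β) := by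
      have : Nonempty (Fin p) := ⟨⟨0, hp⟩⟩
      exact Finset.sum_pos (fun j _ => Real.rpow_pos_of_pos (hq j) _) Finset.univ_nonempty
    positivity
  -- On the root the series equals `κ/ε²`, so this reads `κ^((2β+1)/β) ε⁻² → B/(2β+1)`. The power
  -- `1/(2β+1)` turns it into a statement about `ε^(4β/(2β+1)) / (ε² κ^(-1/β))`.
  have hA := (tendsto_rpow_mul_tsum_coeff hβ hq).comp (tendsto_pinskerRoot_zero hβ hq hκ)
  rw [← hB] at hA
  have hA' := (hA.rpow_const (p := 1 / (2 * β + 1)) (Or.inl (by positivity))).const_mul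
    ((2 * β + 1) ^ (1 / (2 * β + 1)) * B ^ (2 * β / (2 * β + 1)))
  rw [pinsker_constant_mul_rpow hβ hBpos] at hA'
  refine hA'.congr' ?_
  filter_upwards [self_mem_nhdsWithin] with ε hε
  have hε : 0 < ε := hε
  obtain ⟨hk, hroot⟩ := hκ ε hε
  have hsum := tsum_coeff_mul_sum_eq hk hroot
  simp only [Function.comp]
  have e1 : ∑' i, ∑ j, sobolevCoeff β (i + 1) * pinskerWeight β (q j) (κ ε) i = κ ε / ε ^ 2 := by
    rw [eq_div_iff (by positivity)]
    linarith
  rw [e1, mul_div_assoc ((2 * β + 1) ^ (1 / (2 * β + 1)) * B ^ (2 * β / (2 * β + 1)))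
    (ε ^ (4 * β / (2 * β + 1)))]
  congr 1
  have e2 : κ ε ^ (1 + 1 / β) * (κ ε / ε ^ 2) = κ ε ^ ((2 * β + 1) / β) * ε ^ (-2 : ℝ) := by
    have : κ ε ^ ((2 * β + 1) / β) = κ ε ^ (1 + 1 / β) * κ ε := by
      rw [← Real.rpow_add_one hk.ne']
      congr 1
      field_simp
      ring
    rw [this, Real.rpow_neg hε.le, Real.rpow_two]
    field_simp
  rw [e2, Real.mul_rpow (by positivity) (by positivity), ← Real.rpow_mul hk.le,
    ← Real.rpow_mul hε.le, Real.rpow_neg hk.le, ← Real.rpow_two]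
  have e3 : (2 * β + 1) / β * (1 / (2 * β + 1)) = 1 / β := by field_simp
  have e4 : ε ^ (4 * β / (2 * β + 1)) = ε ^ (-2 * (1 / (2 * β + 1))) * ε ^ (2 : ℝ) := by
    rw [← Real.rpow_add hε]
    congr 1
    field_simp
    ring
  rw [e3, e4]
  have : κ ε ^ (1 / β) ≠ 0 := by positivity
  have : ε ^ (2 : ℝ) ≠ 0 := by positivity
  field_simp

/-- The lower bound with `δ = κ ^ s` and the dropped frequencies `n = ⌈δ κ^{-1/β}⌉`. -/
theorem eventually_lower_bound (hβ : 0 < β) (hq : ∀ j, 0 < q j) {κ : ℝ → ℝ}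
    (hκ : ∀ ε, 0 < ε → 0 < κ ε ∧ ε ^ 2 * pinskerSum β q (κ ε)⁻¹ = 1) {B : ℝ}
    (hB : B = β * (∑ j, q j ^ ((β + 1) / β)) / (β + 1)) :
    ∃ L : ℝ → ℝ, Tendsto L (𝓝[>] 0) (𝓝 B) ∧ ∀ᶠ ε in 𝓝[>] 0, ∀ f : Seq p → Seq p, Measurable f →
      ∀ M : ℝ≥0∞, (∀ θ ∈ diagEllipsoid β q, diagRisk q ε θ f ≤ M) →
        ENNReal.ofReal (ε ^ 2 * κ ε ^ (-(1 / β)) * L ε) ≤ M := by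
  obtain ⟨b, hb0, hb⟩ : ∃ b, 0 < b ∧ ∀ j, q j ≤ b := by
    refine ⟨1 + ∑ j, q j, ?_, fun j => ?_⟩
    · have := Finset.sum_nonneg fun j (_ : j ∈ Finset.univ) => (hq j).le
      linarith
    · have := Finset.single_le_sum (f := q) (fun j _ => (hq j).le) (Finset.mem_univ j)
      linarith
  -- Chosen so that `δ^(2β+2) = κ^(1/(2β))`. With `n ≥ δ κ^(-1/β)` the variance error is at most `C
  -- ε² δ^(-(2β+2))`, and relative to `ε² κ^(-1/β)` this is `C κ^(1/(2β)) → 0`.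
  set s : ℝ := 1 / (2 * β * (2 * β + 2)) with hs
  have hs0 : 0 < s := by positivity
  set C : ℝ := 10 * b ^ 3 * sqVariance with hC
  have hC0 : 0 ≤ C := mul_nonneg (by positivity) (variance_nonneg _ _)
  have hκ0 := tendsto_pinskerRoot_zero hβ hq hκ
  have hpow : ∀ r : ℝ, 0 < r → Tendsto (fun k : ℝ => k ^ r) (𝓝[>] 0) (𝓝 0) := fun r hr => by
    have := (Real.continuous_rpow_const hr.le).tendsto 0
    rw [Real.zero_rpow hr.ne'] at this
    exact this.mono_left nhdsWithin_le_nhds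
  -- The lower bound divided by `ε² k^(-1/β)`. Of the dropped frequencies, `k ^ s` is the main share
  -- and `k ^ (1 / β)` pays for rounding `n` up.
  let G : ℝ → ℝ := fun k => (1 - k ^ s) *
    (k ^ (1 / β) * ∑' i, ∑ j, q j * pinskerWeight β (q j) k i
      - (k ^ s + k ^ (1 / β)) * ∑ j, q j) - C * k ^ (1 / (2 * β))
  have hG : Tendsto G (𝓝[>] 0) (𝓝 B) := by
    have h := (((tendsto_const_nhds (x := (1 : ℝ))).sub (hpow s hs0)).mul
      ((tendsto_rpow_mul_tsum_sum_pinskerWeight hβ hq).sub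
        (((hpow s hs0).add (hpow (1 / β) (by positivity))).mul_const (∑ j, q j)))).sub
      ((hpow (1 / (2 * β)) (by positivity)).const_mul C)
    rw [← hB, show (1 - 0) * (B - (0 + 0) * ∑ j, q j) - C * 0 = B by ring] at h
    exact h
  refine ⟨G ∘ κ, hG.comp hκ0, ?_⟩
  have hsmall : ∀ᶠ ε in 𝓝[>] 0, κ ε < 1 :=
    (hκ0.mono_right nhdsWithin_le_nhds).eventually_lt_const one_pos
  filter_upwards [self_mem_nhdsWithin, hsmall] with ε hε hk1 f hf M hM
  have hε : 0 < ε := hε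
  obtain ⟨hk, hroot⟩ := hκ ε hε
  simp only [Function.comp]
  generalize κ ε = k at hk1 hk hroot ⊢
  set δ := k ^ s with hδ
  have hδ0 : 0 < δ := Real.rpow_pos_of_pos hk _
  have hδ1 : δ < 1 := Real.rpow_lt_one hk.le hk1 hs0
  have hK : 0 < k ^ (1 / β) := Real.rpow_pos_of_pos hk _
  have hKn : k ^ (-(1 / β)) = (k ^ (1 / β))⁻¹ := Real.rpow_neg hk.le _
  set n := ⌈δ * k ^ (-(1 / β))⌉₊ with hn
  have hn1 : δ * k ^ (-(1 / β)) ≤ n := Nat.le_ceil _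
  have hn2 : (n : ℝ) ≤ δ * k ^ (-(1 / β)) + 1 := (Nat.ceil_lt_add_one (by positivity)).le
  have hn0 : 0 < n := Nat.ceil_pos.2 (by positivity)
  have hnβ : δ ^ β * k⁻¹ ≤ (n : ℝ) ^ β := by
    have h := Real.rpow_le_rpow (by positivity) hn1 hβ.le
    rwa [Real.mul_rpow hδ0.le (by positivity), ← Real.rpow_mul hk.le (-(1 / β)) β,
      show -(1 / β) * β = -1 by field_simp, Real.rpow_neg_one] at h
  refine le_trans (ENNReal.ofReal_le_ofReal ?_)
    (lower_bound_of_diagRisk_le hβ hq hε hk hroot hb hb0 hδ0 hδ1 hn0 hf hM)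
  have hsumq : 0 ≤ ∑ j, q j := Finset.sum_nonneg fun j _ => (hq j).le
  have hfirst : ε ^ 2 * k ^ (-(1 / β)) *
      (k ^ (1 / β) * ∑' i, ∑ j, q j * pinskerWeight β (q j) k i
        - (δ + k ^ (1 / β)) * ∑ j, q j)
      ≤ pinskerBound β q ε k - ε ^ 2 * (n * ∑ j, q j) := by
    have e : ε ^ 2 * k ^ (-(1 / β)) * (k ^ (1 / β) * ∑' i, ∑ j, q j * pinskerWeight β (q j) k i
        - (δ + k ^ (1 / β)) * ∑ j, q j)
        = pinskerBound β q ε k - ε ^ 2 * ((δ * k ^ (-(1 / β)) + 1) * ∑ j, q j) := by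
      unfold pinskerBound
      rw [hKn]
      field_simp
    rw [e]
    gcongr
  have hV : 0 ≤ sqVariance := variance_nonneg _ _
  have hsecond : 10 * (b / (n : ℝ) ^ β) ^ 2 / δ ^ 2 * (sqVariance * (ε ^ 2 * b / k ^ 2))
      ≤ ε ^ 2 * k ^ (-(1 / β)) * (C * k ^ (1 / (2 * β))) := by
    have hpos : 0 < δ ^ β * k⁻¹ := by positivity
    have h1 : 10 * (b / (n : ℝ) ^ β) ^ 2 / δ ^ 2 * (sqVariance * (ε ^ 2 * b / k ^ 2))
        ≤ 10 * (b / (δ ^ β * k⁻¹)) ^ 2 / δ ^ 2 * (sqVariance * (ε ^ 2 * b / k ^ 2)) := by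
      gcongr
    refine h1.trans (le_of_eq ?_)
    have e1 : δ ^ β * δ ^ β * δ ^ 2 = k ^ (1 / (2 * β)) := by
      rw [← Real.rpow_two, ← Real.rpow_add hδ0, ← Real.rpow_add hδ0, hδ, ← Real.rpow_mul hk.le]
      congr 1
      rw [hs]
      field_simp
      ring
    have e2 : k ^ (1 / β) = k ^ (1 / (2 * β)) * k ^ (1 / (2 * β)) := by
      rw [← Real.rpow_add hk]
      congr 1
      field_simp
      ring
    have hh : 0 < k ^ (1 / (2 * β)) := Real.rpow_pos_of_pos hk _
    have e3 : ε ^ 2 * k ^ (-(1 / β)) * (C * k ^ (1 / (2 * β))) = ε ^ 2 * C / k ^ (1 / (2 * β)) := by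
      rw [hKn, e2]
      field_simp
    rw [e3, ← e1, hC]
    have : 0 < δ ^ β := by positivity
    field_simp
  have h1δ : 0 ≤ 1 - δ := by linarith
  calc ε ^ 2 * k ^ (-(1 / β)) * G k
      = (1 - δ) * (ε ^ 2 * k ^ (-(1 / β)) *
        (k ^ (1 / β) * ∑' i, ∑ j, q j * pinskerWeight β (q j) k i
          - (δ + k ^ (1 / β)) * ∑ j, q j)) - ε ^ 2 * k ^ (-(1 / β)) * (C * k ^ (1 / (2 * β))) := by
        simp only [G, ← hδ]
        ring
    _ ≤ _ := by gcongr

/-- Both bounds are compared with the claimed rate `v` through the common scale `e = ε² κ^(-1/β)`.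
-/
lemma tendsto_ofReal_div_one {u v : ℝ → ℝ} {e : ℝ → ℝ} {B : ℝ} (hB : 0 < B)
    (he : ∀ᶠ ε in 𝓝[>] 0, 0 < e ε) (hv : Tendsto (fun ε => v ε / e ε) (𝓝[>] 0) (𝓝 B))
    (hu : Tendsto u (𝓝[>] 0) (𝓝 B)) :
    Tendsto (fun ε => ENNReal.ofReal (e ε * u ε) / ENNReal.ofReal (v ε)) (𝓝[>] 0) (𝓝 1) := by
  have h := ENNReal.tendsto_ofReal (hu.div hv hB.ne')
  rw [div_self hB.ne', ENNReal.ofReal_one] at h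
  refine h.congr' ?_
  filter_upwards [he, hv.eventually_const_lt hB] with ε h1 h2
  have hvpos : 0 < v ε := by
    have := mul_pos h2 h1
    rwa [div_mul_cancel₀ _ h1.ne'] at this
  rw [← ENNReal.ofReal_div_of_pos hvpos]
  congr 1
  simp only [Pi.div_apply]
  field_simp

end MPinsker

end

/-! ### Assembly of the theorem. -/

open MPinsker in
theorem mainTheorem2 (p : ℕ) (hp : 0 < p) (β : ℝ) (hβ : 0 < β)
    (Q : Matrix (Fin p) (Fin p) ℝ) (hQ : Q.PosDef) :
    (∀ ε : ℝ, 0 < ε → ∃! κ : ℝ, MPinsker.IsPinskerRoot β Q ε κ) ∧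
    ∀ κ : ℝ → ℝ, (∀ ε : ℝ, 0 < ε → MPinsker.IsPinskerRoot β Q ε (κ ε)) →
      MPinsker.AsympEquiv
        (fun ε => MPinsker.maxRisk Q ε (MPinsker.sobolevEllipsoid β Q)
          (MPinsker.linearEstimator (MPinsker.pinskerCoeff β Q (κ ε))))
        (fun ε => MPinsker.minimaxRisk Q ε (MPinsker.sobolevEllipsoid β Q)) ∧
      MPinsker.AsympEquiv
        (fun ε => MPinsker.maxRisk Q ε (MPinsker.sobolevEllipsoid β Q)
          (MPinsker.linearEstimator (MPinsker.pinskerCoeff β Q (κ ε))))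
        (fun ε => ENNReal.ofReal
          (MPinsker.pinskerConst β Q * ε ^ (4 * β / (2 * β + 1)))) ∧
      MPinsker.AsympEquiv
        (fun ε => MPinsker.minimaxRisk Q ε (MPinsker.sobolevEllipsoid β Q))
        (fun ε => ENNReal.ofReal
          (MPinsker.pinskerConst β Q * ε ^ (4 * β / (2 * β + 1)))) := by
  obtain ⟨U, q, hD⟩ := exists_isDiagonalization hQ
  refine ⟨fun ε hε => hD.existsUnique_isPinskerRoot hQ hp hβ hε, fun κ hκ' => ?_⟩
  have hq := hD.pos
  have hκ : ∀ ε, 0 < ε → 0 < κ ε ∧ ε ^ 2 * pinskerSum β q (κ ε)⁻¹ = 1 := fun ε hε =>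
    (hD.isPinskerRoot_iff hQ _ _).1 (hκ' ε hε)
  obtain ⟨B, hB⟩ : ∃ B, B = β * (∑ j, q j ^ ((β + 1) / β)) / (β + 1) := ⟨_, rfl⟩
  have hBpos : 0 < B := by
    have : Nonempty (Fin p) := ⟨⟨0, hp⟩⟩
    have : 0 < ∑ j, q j ^ ((β + 1) / β) :=
      Finset.sum_pos (fun j _ => Real.rpow_pos_of_pos (hq j) _) Finset.univ_nonempty
    rw [hB]
    positivity
  have hconst : pinskerConst β Q
      = (2 * β + 1) ^ (1 / (2 * β + 1)) * B ^ (2 * β / (2 * β + 1)) := by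
    unfold pinskerConst
    rw [hD.trace_matRpow, hB]
  set e : ℝ → ℝ := fun ε => ε ^ 2 * κ ε ^ (-(1 / β)) with he
  have hepos : ∀ᶠ ε in 𝓝[>] (0 : ℝ), 0 < e ε := by
    filter_upwards [self_mem_nhdsWithin] with ε hε
    have hε : 0 < ε := hε
    have := (hκ ε hε).1
    positivity
  set v : ℝ → ℝ := fun ε => pinskerConst β Q * ε ^ (4 * β / (2 * β + 1)) with hv
  have hve : Tendsto (fun ε => v ε / e ε) (𝓝[>] 0) (𝓝 B) := by
    simp only [hv, hconst]
    exact tendsto_rate_div hβ hq hp hκ hB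
  obtain ⟨L, hL, hlow⟩ := eventually_lower_bound hβ hq hκ hB
  have hup := (tendsto_rpow_mul_tsum_sum_pinskerWeight hβ hq).comp
    (tendsto_pinskerRoot_zero hβ hq hκ)
  rw [← hB] at hup
  have hlow1 := tendsto_ofReal_div_one hBpos hepos hve hL
  have hup1 := tendsto_ofReal_div_one hBpos hepos hve hup
  set R : ℝ → ℝ≥0∞ := fun ε => maxRisk Q ε (sobolevEllipsoid β Q)
    (linearEstimator (pinskerCoeff β Q (κ ε))) with hR
  set m : ℝ → ℝ≥0∞ := fun ε => minimaxRisk Q ε (sobolevEllipsoid β Q) with hm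
  have hmR : ∀ ε, m ε ≤ R ε := fun ε => iInf_le _ _
  have hRup : ∀ᶠ ε in 𝓝[>] (0 : ℝ), R ε ≤ ENNReal.ofReal (e ε * ((fun κ : ℝ => κ ^ (1 / β) *
      ∑' i, ∑ j, q j * pinskerWeight β (q j) κ i) ∘ κ) ε) := by
    filter_upwards [self_mem_nhdsWithin] with ε hε
    obtain ⟨hk, hroot⟩ := hκ ε hε
    have hbound : e ε * ((fun κ : ℝ => κ ^ (1 / β) *
        ∑' i, ∑ j, q j * pinskerWeight β (q j) κ i) ∘ κ) ε = pinskerBound β q ε (κ ε) := by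
      simp only [he, Function.comp, pinskerBound]
      rw [Real.rpow_neg hk.le]
      have : κ ε ^ (1 / β) ≠ 0 := by positivity
      field_simp
    rw [hbound]
    refine iSup₂_le fun θ hθ => ?_
    rw [hD.risk_eq hQ]
    simp only [hD.mulVec_pinskerCoeff hQ]
    exact diagRisk_pinsker_le hβ hq hk hroot ((hD.mem_sobolevEllipsoid_iff hQ θ).1 hθ)
  have hmlow : ∀ᶠ ε in 𝓝[>] (0 : ℝ), ENNReal.ofReal (e ε * L ε) ≤ m ε := by
    filter_upwards [hlow] with ε hlow
    refine le_iInf fun f => ?_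
    -- Every estimator of the original problem is conjugated into the diagonal one, and every
    -- diagonal parameter is the rotation of a point of the original ellipsoid.
    refine hlow (fun y => mulVecSeq Uᵀ (f.1 (mulVecSeq U y)))
      ((measurable_mulVecSeq _).comp (f.2.comp (measurable_mulVecSeq _))) _ fun θ hθ => ?_
    have hθ' : mulVecSeq U θ ∈ sobolevEllipsoid β Q := by
      rw [hD.mem_sobolevEllipsoid_iff hQ, hD.mulVecSeq_transpose_mulVecSeq]
      exact hθ
    refine le_trans (le_of_eq ?_) (le_iSup₂_of_le (mulVecSeq U θ) hθ' le_rfl)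
    rw [hD.risk_eq hQ, hD.mulVecSeq_transpose_mulVecSeq]
  have hRv : Tendsto (fun ε => R ε / ENNReal.ofReal (v ε)) (𝓝[>] 0) (𝓝 1) := by
    refine tendsto_of_tendsto_of_tendsto_of_le_of_le' hlow1 hup1 ?_ ?_
    · filter_upwards [hmlow] with ε h
      exact ENNReal.div_le_div_right (h.trans (hmR ε)) _
    · filter_upwards [hRup] with ε h
      exact ENNReal.div_le_div_right h _
  have hmv : Tendsto (fun ε => m ε / ENNReal.ofReal (v ε)) (𝓝[>] 0) (𝓝 1) := by
    refine tendsto_of_tendsto_of_tendsto_of_le_of_le' hlow1 hup1 ?_ ?_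
    · filter_upwards [hmlow] with ε h
      exact ENNReal.div_le_div_right h _
    · filter_upwards [hRup] with ε h
      exact ENNReal.div_le_div_right ((hmR ε).trans h) _
  refine ⟨?_, hRv, hmv⟩
  -- The remaining equivalence is the quotient of the other two; the common denominator cancels
  -- because it is eventually positive and finite.
  have h := ENNReal.Tendsto.div hRv (Or.inl one_ne_zero) hmv (Or.inl ENNReal.one_ne_top)
  rw [div_one] at h
  refine h.congr' ?_
  filter_upwards [hepos, hve.eventually_const_lt hBpos] with ε h1 h2
  have hvpos : 0 < v ε := by
    have := mul_pos h2 h1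
    rwa [div_mul_cancel₀ _ h1.ne'] at this
  have hv0 : (ENNReal.ofReal (v ε))⁻¹ ≠ 0 := ENNReal.inv_ne_zero.2 ENNReal.ofReal_ne_top
  have hvt : (ENNReal.ofReal (v ε))⁻¹ ≠ ∞ :=
    ENNReal.inv_ne_top.2 (ENNReal.ofReal_pos.2 hvpos).ne'
  simp only [div_eq_mul_inv (_ : ℝ≥0∞) (ENNReal.ofReal (v ε))]
  exact ENNReal.mul_div_mul_right _ _ hv0 hvt
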